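/- **Setting.** A fleet of $M$ agents communicates over an undirected time-varying graph $\mathcal G(t)=(\{1,\dots,M\},\mathcal E(t))$, $t=0,1,2,\dots$, with neighbourhoods $\mathcal N_i(t)$. Connectivity: there is an integer $\gamma\ge 1$ such that for every $t$ the graph with edge set $\mathcal E(t\gamma)\cup\mathcal E(t\gamma+1)\cup\dots\cup\mathcal E((t+1)\gamma-1)$ is connected. Let $k(x,x')=\sigma_f^2\exp\{-\sum_{d=1}^D (x_d-x'_d)^2/l_d^2\}$ on $\mathbb R^D$ with $\sigma_f,l_d>0$. Agent $i$ observes $y_{i,j}=f(x_{i,j})+e_{i,j}$, $j=1,2,\dots$, where $x_{i,j}\in\mathbb R^D$ are fixed inputs, $f$ is a centred Gaussian process with covariance $k$, and the $e_{i,j}$ are i.i.d. $\mathcal N(0,\sigma_\epsilon^2)$, $\sigma_\epsilon>0$, independent of $f$. Assume that no input is isolated: every neighbourhood of every $x_{i,j}$ contains the inputs of infinitely many observations of the fleet. (This holds, for instance, when all inputs lie in a set without isolated points and are dense in it.) For a finite dataset $A$ with inputs $X_A$ and outputs $y_A$ and a location $z\in\mathbb R^D$, put $k_A=k(X_A,z)$,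 $C_A=k(X_A,X_A)+\sigma_\epsilon^2 I$, and $$\mu_A(z)=k_A^{\top}C_A^{-1}y_A,\qquad \sigma_A^2(z)=k(z,z)-k_A^{\top}C_A^{-1}k_A .$$ For $n\ge 0$ the local dataset $\mathcal D_i$ consists of the first $n$ observations of agent $i$, and the full dataset is $\bigcup_i\mathcal D_i$, with $N=Mn$ observations; its predictions are $\mu_{\rm full},\sigma^2_{\rm full}$. Partial data exchange: each agent draws $\lfloor n/M\rfloor$ observations from $\mathcal D_i$ uniformly at random without replacement, the draws being independent of $f$ and of the noise. The communication dataset $\mathcal D_{\rm c}$ is the union of the drawn samples, $\mathcal D_{+i}=\mathcal D_i\cup\mathcal D_{\rm c}$, and $\mu_{\rm c},\sigma_{\rm c}^2$, $\mu_{+i},\sigma_{+i}^2$ are the corresponding predictions. The weights are $\beta_i=\tfrac12[\log\sigma_{\rm c}^2(z)-\log\sigma_{+i}^2(z)]$ for all $i$, or, alternatively, the same for $i\ge2$ and $\beta_1=1$. The grBCM (the aggregation rule derived by treating the local models as independent and the local datasets as conditionally independent) is $$\sigma_{\rm grBCM}^{-2}=\sum_{i=1}^M\beta_i\sigma_{+i}^{-2}+\Big(1-\sum_{i=1}^M\beta_i\Big)\sigma_{\rm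 c}^{-2},\qquad \mu_{\rm grBCM}=\sigma_{\rm grBCM}^2\Big(\sum_{i=1}^M\beta_i\sigma_{+i}^{-2}\mu_{+i}-\Big(\sum_{i=1}^M\beta_i-1\Big)\sigma_{\rm c}^{-2}\mu_{\rm c}\Big).$$ Discrete-time average consensus (DAC) with parameter $\epsilon$, started at time $t_0$ from $w^{(0)}\in\mathbb R^M$, is $$w_i^{(s+1)}=w_i^{(s)}+\epsilon\sum_{j\in\mathcal N_i(t_0+s)}\big(w_j^{(s)}-w_i^{(s)}\big).$$ The DEC-grBCM runs DAC three times, from $w_{\mu,i}^{(0)}=\beta_i\sigma_{+i}^{-2}\mu_{+i}$, $w_{\sigma^{-2},i}^{(0)}=\beta_i\sigma_{+i}^{-2}$ and $w_{\beta,i}^{(0)}=\beta_i$. Knowing $M$, agent $i$ forms after $s$ steps $$\sigma_{{\rm DEC},i}^{-2}=Mw_{\sigma^{-2},i}^{(s)}+\big(1-Mw_{\beta,i}^{(s)}\big)\sigma_{\rm c}^{-2},\qquad \mu_{{\rm DEC},i}=\sigma_{{\rm DEC},i}^2\Big(Mw_{\mu,i}^{(s)}-\big(Mw_{\beta,i}^{(s)}-1\big)\sigma_{\rm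 c}^{-2}\mu_{\rm c}\Big).$$ **Proposition.** Let $\epsilon>0$ with $\epsilon\,|\mathcal N_i(t)|<1$ for all $i,t$, that is, $\epsilon\in(0,1/\Delta)$ with $\Delta$ the maximum degree. Then, for either choice of the weights: 1. For any initialization $w^{(0)}\in\mathbb R^M$ and any starting time $t_0$, every component of the DAC iterates converges to $\frac1M\sum_j w_j^{(0)}$ as $s\to\infty$. 2. For every $n$, every $z\in\mathbb R^D$, every realization and every $t_0$, the DEC-grBCM mean and variance of all agents converge as $s\to\infty$ to common limits $\mu_{\rm DEC}(z)$ and $\sigma^2_{\rm DEC}(z)$, namely $\mu_{\rm grBCM}(z)$ and $\sigma^2_{\rm grBCM}(z)$. 3. The DEC-grBCM is consistent: for every $z\in\mathbb R^D$, as $n\to\infty$, $$\mu_{\rm full}(z)-\mu_{\rm DEC}(z)\to0\quad\text{and}\quad\sigma^2_{\rm full}(z)-\sigma^2_{\rm DEC}(z)\to0$$ in mean square with respect to the joint law of the Gaussian process, the noise and the random samples. -/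

import Mathlib

open MeasureTheory ProbabilityTheory Filter Topology
open scoped ENNReal NNReal Matrix

namespace DecGP

noncomputable section

/-! ### Gaussian process regression -/

/-- The input space `ℝ^D`. -/
abbrev Input (D : ℕ) := EuclideanSpace ℝ (Fin D)

/-- Hyperparameters `θ = (l₁, …, l_D, σ_f, σ_ε)`, all positive. -/
structure Hyper (D : ℕ) where
  lengthScale : Fin D → ℝ
  signalStd : ℝ
  noiseStd : ℝ
  lengthScale_pos : ∀ d, 0 < lengthScale d
  signalStd_pos : 0 < signalStd
  noiseStd_pos : 0 < noiseStd

/-- The separable squared exponential covariance function. -/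
def Hyper.kernel {D : ℕ} (θ : Hyper D) (x x' : Input D) : ℝ :=
  θ.signalStd ^ 2 * Real.exp (-∑ d, (x d - x' d) ^ 2 / θ.lengthScale d ^ 2)

/-- The label `(i, j)` of the `j`-th observation of agent `i`.  A dataset is a finite set of
labels, so that the union of two datasets contains each observation once. -/
abbrev Obs (M : ℕ) := Fin M × ℕ

section Posterior

variable {D M : ℕ} (θ : Hyper D) (x : Obs M → Input D) (y : Obs M → ℝ) (A : Finset (Obs M))

/-- `C_θ = k(X, X) + σ_ε² I` for the dataset `A`. -/
def dataCov : Matrix A A ℝ :=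
  Matrix.of (fun a b : A => θ.kernel (x a) (x b)) + θ.noiseStd ^ 2 • (1 : Matrix A A ℝ)

/-- `k_* = k(X, z)` for the dataset `A` and the location `z`. -/
def crossCov (z : Input D) : A → ℝ := fun a => θ.kernel (x a) z

/-- GP prediction mean `k_*ᵀ C_θ⁻¹ y` at `z` from the dataset `A`. -/
def postMean (z : Input D) : ℝ :=
  crossCov θ x A z ⬝ᵥ ((dataCov θ x A)⁻¹ *ᵥ (fun a : A => y a))

/-- GP prediction variance `k_** - k_*ᵀ C_θ⁻¹ k_*` at `z` from the dataset `A`. -/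
def postVar (z : Input D) : ℝ :=
  θ.kernel z z - crossCov θ x A z ⬝ᵥ ((dataCov θ x A)⁻¹ *ᵥ crossCov θ x A z)

end Posterior

/-! ### Datasets of the fleet -/

/-- The local dataset of agent `i`: its first `n` observations. -/
def localData {M : ℕ} (n : ℕ) (i : Fin M) : Finset (Obs M) := {i} ×ˢ Finset.range n

/-- The global dataset, with `N = M n` observations. -/
def fullData (M n : ℕ) : Finset (Obs M) := Finset.univ ×ˢ Finset.range n

/-- The communication dataset: the union of the samples `S i` of all agents. -/
def commData {M : ℕ} (S : Fin M → Finset ℕ) : Finset (Obs M) :=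
  Finset.univ.biUnion fun i => {i} ×ˢ S i

/-- The local augmented dataset `D_{+i} = D_i ∪ D_c`. -/
def augData {M : ℕ} (n : ℕ) (S : Fin M → Finset ℕ) (i : Fin M) : Finset (Obs M) :=
  localData n i ∪ commData S

/-! ### Average consensus -/

open Classical in
/-- Discrete-time average consensus with parameter `ε` over the time-varying graph `G`,
started at time `t₀` from `w₀`; `dac G ε t₀ w₀ s i` is the value of agent `i` after `s` steps. -/
def dac {M : ℕ} (G : ℕ → SimpleGraph (Fin M)) (ε : ℝ) (t₀ : ℕ) (w₀ : Fin M → ℝ) :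
    ℕ → Fin M → ℝ
  | 0 => w₀
  | s + 1 => fun i =>
      dac G ε t₀ w₀ s i + ε * ∑ j, (if (G (t₀ + s)).Adj i j then
        dac G ε t₀ w₀ s j - dac G ε t₀ w₀ s i else 0)

/-- Repeated joint connectivity: for some window length `γ ≥ 1`, the union of the graphs at the
times `tγ, tγ + 1, …, (t+1)γ - 1` is connected for every `t`. -/
def RepeatedlyConnected {M : ℕ} (G : ℕ → SimpleGraph (Fin M)) : Prop :=
  ∃ γ : ℕ, 0 < γ ∧ ∀ t : ℕ, (⨆ s ∈ Finset.Ico (t * γ) ((t + 1) * γ), G s).Connected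

/-! ### DEC-grBCM -/

section DEC

variable {D M : ℕ} (θ : Hyper D) (x : Obs M → Input D) (y : Obs M → ℝ)
  (unitFirst : Bool) (n : ℕ) (S : Fin M → Finset ℕ) (z : Input D)

/-- The weights `β_i = (log σ_c² - log σ_{+i}²) / 2`, where the first agent gets the weight `1`
instead if `unitFirst` is true. -/
def grbcmWeight (i : Fin M) : ℝ :=
  if unitFirst = true ∧ (i : ℕ) = 0 then 1
  else (1 / 2) * (Real.log (postVar θ x (commData S) z) -
    Real.log (postVar θ x (augData n S i) z))

variable (G : ℕ → SimpleGraph (Fin M)) (ε : ℝ) (t₀ : ℕ)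

/-- The consensus run on `β_i`. -/
def runWeight : ℕ → Fin M → ℝ :=
  dac G ε t₀ fun i => grbcmWeight θ x unitFirst n S z i

/-- The consensus run on `β_i σ_{+i}⁻²`. -/
def runPrec : ℕ → Fin M → ℝ :=
  dac G ε t₀ fun i => grbcmWeight θ x unitFirst n S z i * (postVar θ x (augData n S i) z)⁻¹

/-- The consensus run on `β_i σ_{+i}⁻² μ_{+i}`. -/
def runMean : ℕ → Fin M → ℝ :=
  dac G ε t₀ fun i => grbcmWeight θ x unitFirst n S z i * (postVar θ x (augData n S i) z)⁻¹ *
    postMean θ x y (augData n S i) z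

/-- The predictive variance that agent `i` forms after `s` consensus steps; its inverse is
`M w_{σ⁻²,i} + (1 - M w_{β,i}) σ_c⁻²`. -/
def decVar (s : ℕ) (i : Fin M) : ℝ :=
  (M * runPrec θ x unitFirst n S z G ε t₀ s i +
    (1 - M * runWeight θ x unitFirst n S z G ε t₀ s i) *
      (postVar θ x (commData S) z)⁻¹)⁻¹

/-- The predictive mean that agent `i` forms after `s` consensus steps:
`σ² (M w_{μ,i} - (M w_{β,i} - 1) σ_c⁻² μ_c)`. -/
def decMean (s : ℕ) (i : Fin M) : ℝ :=
  decVar θ x unitFirst n S z G ε t₀ s i *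
    (M * runMean θ x y unitFirst n S z G ε t₀ s i -
      (M * runWeight θ x unitFirst n S z G ε t₀ s i - 1) *
        (postVar θ x (commData S) z)⁻¹ * postMean θ x y (commData S) z)

/-- The predictive variance of the centralized grBCM. -/
def grbcmVar : ℝ :=
  (∑ i, grbcmWeight θ x unitFirst n S z i * (postVar θ x (augData n S i) z)⁻¹ +
    (1 - ∑ i, grbcmWeight θ x unitFirst n S z i) * (postVar θ x (commData S) z)⁻¹)⁻¹

/-- The predictive mean of the centralized grBCM. -/
def grbcmMean : ℝ :=
  grbcmVar θ x unitFirst n S z *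
    (∑ i, grbcmWeight θ x unitFirst n S z i * (postVar θ x (augData n S i) z)⁻¹ *
        postMean θ x y (augData n S i) z -
      (∑ i, grbcmWeight θ x unitFirst n S z i - 1) *
        (postVar θ x (commData S) z)⁻¹ * postMean θ x y (commData S) z)

end DEC

/-! ### Consistency -/

/-- Consistency of an aggregation method: as the number of observations grows, its predictive
mean and variance and those of the full GP have differences that tend to zero at every location,
in mean square under the law of the data and of the sampling. -/
def Consistent {D : ℕ} {Ω : Type*} [MeasurableSpace Ω] (P : Measure Ω)
    (muFull varFull muA varA : ℕ → Input D → Ω → ℝ) : Prop :=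
  ∀ z : Input D,
    Tendsto (fun n => eLpNorm (fun ω => muFull n z ω - muA n z ω) 2 P) atTop (𝓝 0) ∧
    Tendsto (fun n => eLpNorm (fun ω => varFull n z ω - varA n z ω) 2 P) atTop (𝓝 0)

/-! ### The data -/

/-- The observation model of the fleet: the latent function `f` is a centred Gaussian process with
covariance `θ.kernel`, the noise `e` is i.i.d. `N(0, σ_ε²)`, agent `i` draws its sample `S n i`
of `⌊n / M⌋` of its first `n` observations uniformly without replacement, and latent function,
noise and samples are independent. -/
structure IsFleetModel {D M : ℕ} {Ω : Type*} [MeasurableSpace Ω] (P : Measure Ω) (θ : Hyper D)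
    (f : Input D → Ω → ℝ) (e : Obs M → Ω → ℝ) (S : ℕ → Fin M → Ω → Finset ℕ) : Prop where
  measurable_f : ∀ z, Measurable (f z)
  gaussian_f : IsGaussianProcess f P
  mean_f : ∀ z, ∫ ω, f z ω ∂P = 0
  cov_f : ∀ z z', covariance (f z) (f z') P = θ.kernel z z'
  measurable_e : ∀ p, Measurable (e p)
  law_e : ∀ p, HasLaw (e p) (gaussianReal 0 (Real.toNNReal (θ.noiseStd ^ 2))) P
  indep_e : iIndepFun e P
  indep_f_e : IndepFun (fun ω z => f z ω) (fun ω p => e p ω) P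
  measurable_S : ∀ n i, Measurable (S n i)
  law_S : ∀ n i, HasLaw (S n i)
    (uniformOn (Finset.powersetCard (n / M) (Finset.range n) : Set (Finset ℕ))) P
  indep_S : IndepFun (fun ω n i => S n i ω)
    (fun ω => ((fun z => f z ω : Input D → ℝ), (fun p => e p ω : Obs M → ℝ))) P

/-- The outputs `y = f(x) + ε`. -/
def outputs {D M : ℕ} {Ω : Type*} (x : Obs M → Input D) (f : Input D → Ω → ℝ)
    (e : Obs M → Ω → ℝ) (ω : Ω) : Obs M → ℝ := fun p => f (x p) ω + e p ω

end

end DecGP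

namespace DecGP

/-! ### Gaussian process regression as orthogonal projection -/

/-! Latent values and noise are treated as vectors `F z`, `N p` of an inner product space, later
`L²`. The GP mean is then the orthogonal projection of `F z` onto the span of the outputs, and
`postVar` is the squared distance to that span. Hence more data lowers the variance, and for nested
datasets the squared distance between two predictions is the difference of their variances
(`norm_sq_predictor_sub`).

Consensus: the sum of squares of the iterates is a Lyapunov function whose decrease controls the
differences along the active edges. These differences and the one-step movements therefore vanish,
so over one connectivity window all agents come together; the conserved sum identifies the limit
(`tendsto_dac`). The limits of the DEC-grBCM follow by continuity of the final formulas.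

Consistency does not rest on the independence heuristics behind the grBCM. Each augmented dataset
lies between the communication dataset and the full one. The grBCM mean is an affine combination of
the local means with uniformly bounded coefficients (`abs_sub_aggregated_mean_le`), and its variance
error is at most a constant times the gap between the communication variance and the full variance
(`abs_postVar_sub_grbcmVar_le`). So it suffices that the expected gap tends to zero. The full
variance decreases in `n`, hence nearly reaches its limit at a fixed finite dataset. Each
observation of that dataset can be replaced by an average of many nearby sampled ones, which
averages the noise out (`exists_postVar_le_add`); since no input is isolated, the random samples
supply these with probability tending to one (`tendsto_measure_card_commData_lt`). As the samples
are independent of the data, Fubini turns the expected variance gap into a mean square error of the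
means (`lintegral_sq_postMean_sub_sample`). -/

/-- Vectors `F z` and `N p` of an inner product space that have the second moments of the latent
function and of the noise. -/
structure IsFeatureModel {D M : ℕ} {E : Type*} [NormedAddCommGroup E] [InnerProductSpace ℝ E]
    (θ : Hyper D) (F : Input D → E) (N : Obs M → E) : Prop where
  inner_signal : ∀ z z', inner ℝ (F z) (F z') = θ.kernel z z'
  inner_noise : ∀ p q, inner ℝ (N p) (N q) = if p = q then θ.noiseStd ^ 2 else 0
  inner_signal_noise : ∀ z p, inner ℝ (F z) (N p) = 0

/-- The coefficients of the outputs in the GP prediction mean. -/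
noncomputable def krigingWeight {D M : ℕ} (θ : Hyper D) (x : Obs M → Input D)
    (A : Finset (Obs M)) (z : Input D) : A → ℝ :=
  (dataCov θ x A)⁻¹ *ᵥ crossCov θ x A z

/-- The GP prediction mean for outputs in a vector space. -/
noncomputable def predictor {D M : ℕ} {E : Type*} [NormedAddCommGroup E] [InnerProductSpace ℝ E]
    (θ : Hyper D) (x : Obs M → Input D) (Y : Obs M → E) (A : Finset (Obs M)) (z : Input D) : E :=
  ∑ a : A, krigingWeight θ x A z a • Y a

lemma Hyper.kernel_self {D : ℕ} (θ : Hyper D) (z : Input D) :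
    θ.kernel z z = θ.signalStd ^ 2 := by
  simp [Hyper.kernel]

lemma Hyper.kernel_comm {D : ℕ} (θ : Hyper D) (z z' : Input D) :
    θ.kernel z z' = θ.kernel z' z := by
  simp only [Hyper.kernel]
  congr 3
  refine Finset.sum_congr rfl fun d _ => ?_
  ring

lemma Hyper.continuous_kernel_right {D : ℕ} (θ : Hyper D) (z : Input D) :
    Continuous fun z' => θ.kernel z z' := by
  unfold Hyper.kernel
  fun_prop

lemma dataCov_transpose {D M : ℕ} (θ : Hyper D) (x : Obs M → Input D) (A : Finset (Obs M)) :
    (dataCov θ x A)ᵀ = dataCov θ x A := by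
  ext a b
  simp [dataCov, Matrix.one_apply, θ.kernel_comm (x b) (x a), eq_comm]

/-- Symmetry of the covariance moves the inverse from the outputs to `crossCov`, which exhibits the
mean as linear in `y` with deterministic coefficients. -/
lemma postMean_eq_sum {D M : ℕ} (θ : Hyper D) (x : Obs M → Input D) (y : Obs M → ℝ)
    (A : Finset (Obs M)) (z : Input D) :
    postMean θ x y A z = ∑ a : A, krigingWeight θ x A z a * y a := by
  rw [postMean, Matrix.dotProduct_mulVec, ← Matrix.mulVec_transpose, Matrix.transpose_nonsing_inv,
    dataCov_transpose]
  rfl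

namespace IsFeatureModel

variable {D M : ℕ} {E : Type*} [NormedAddCommGroup E] [InnerProductSpace ℝ E]
  {θ : Hyper D} {F : Input D → E} {N : Obs M → E}

/-- The kernel matrix is a Gram matrix of the vectors `F (x a)`, hence positive semidefinite; the
noise term makes the sum positive definite. -/
lemma isUnit_det_dataCov (h : IsFeatureModel θ F N) (x : Obs M → Input D) (A : Finset (Obs M)) :
    IsUnit (dataCov θ x A).det := by
  have hK : (Matrix.of fun a b : A => θ.kernel (x a) (x b)) =
      Matrix.gram ℝ (fun a : A => F (x a)) := by
    ext a b
    simp [Matrix.gram_apply, h.inner_signal]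
  have hC : (dataCov θ x A).PosDef := by
    rw [dataCov, hK]
    exact Matrix.PosDef.posSemidef_add (Matrix.posSemidef_gram ℝ _)
      (Matrix.PosDef.one.smul (pow_pos θ.noiseStd_pos 2))
  exact (Matrix.isUnit_iff_isUnit_det _).mp hC.isUnit

lemma dataCov_mulVec_krigingWeight (h : IsFeatureModel θ F N) (x : Obs M → Input D)
    (A : Finset (Obs M)) (z : Input D) :
    dataCov θ x A *ᵥ krigingWeight θ x A z = crossCov θ x A z := by
  rw [krigingWeight, Matrix.mulVec_mulVec, Matrix.mul_nonsing_inv _ (h.isUnit_det_dataCov x A),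
    Matrix.one_mulVec]

lemma inner_output (h : IsFeatureModel θ F N) (x : Obs M → Input D) (A : Finset (Obs M))
    (a b : A) : inner ℝ (F (x a) + N a) (F (x b) + N b) = dataCov θ x A a b := by
  have h2 : inner ℝ (N a) (F (x b)) = 0 := by rw [real_inner_comm, h.inner_signal_noise]
  simp only [inner_add_left, inner_add_right, h.inner_signal, h.inner_noise,
    h.inner_signal_noise, h2, dataCov, Matrix.add_apply, Matrix.of_apply, Matrix.smul_apply,
    Matrix.one_apply, Subtype.ext_iff]
  simp

lemma inner_signal_output (h : IsFeatureModel θ F N) (x : Obs M → Input D) (z : Input D)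
    (b : Obs M) : inner ℝ (F z) (F (x b) + N b) = θ.kernel (x b) z := by
  rw [inner_add_right, h.inner_signal, h.inner_signal_noise, add_zero, θ.kernel_comm]

/-- The residual of the prediction is orthogonal to the outputs. -/
lemma inner_residual_output (h : IsFeatureModel θ F N) (x : Obs M → Input D)
    (A : Finset (Obs M)) (z : Input D) {b : Obs M} (hb : b ∈ A) :
    inner ℝ (F z - predictor θ x (fun p => F (x p) + N p) A z) (F (x b) + N b) = 0 := by
  have h1 := congrFun (h.dataCov_mulVec_krigingWeight x A z) ⟨b, hb⟩
  rw [inner_sub_left, h.inner_signal_output, predictor, sum_inner, sub_eq_zero]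
  rw [Matrix.mulVec, dotProduct, crossCov] at h1
  rw [← h1]
  refine Finset.sum_congr rfl fun a _ => ?_
  rw [real_inner_smul_left, h.inner_output x A a ⟨b, hb⟩, mul_comm]
  congr 1
  exact congrFun (congrFun (dataCov_transpose θ x A) a) ⟨b, hb⟩

lemma predictor_mem_span (x : Obs M → Input D) (Y : Obs M → E) {A B : Finset (Obs M)}
    (hAB : A ⊆ B) (z : Input D) :
    predictor θ x Y A z ∈ Submodule.span ℝ (Y '' (B : Set (Obs M))) :=
  Submodule.sum_mem _ fun a _ => Submodule.smul_mem _ _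
    (Submodule.subset_span ⟨a, hAB a.2, rfl⟩)

lemma inner_residual_of_mem_span (h : IsFeatureModel θ F N) (x : Obs M → Input D)
    (A : Finset (Obs M)) (z : Input D) {u : E}
    (hu : u ∈ Submodule.span ℝ ((fun p => F (x p) + N p) '' (A : Set (Obs M)))) :
    inner ℝ (F z - predictor θ x (fun p => F (x p) + N p) A z) u = 0 := by
  induction hu using Submodule.span_induction with
  | mem u hu =>
    obtain ⟨b, hb, rfl⟩ := hu
    exact h.inner_residual_output x A z hb
  | zero => exact inner_zero_right _
  | add u v _ _ hu hv => rw [inner_add_right, hu, hv, add_zero]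
  | smul c u _ hu => rw [real_inner_smul_right, hu, mul_zero]

lemma norm_sq_residual (h : IsFeatureModel θ F N) (x : Obs M → Input D)
    (A : Finset (Obs M)) (z : Input D) :
    ‖F z - predictor θ x (fun p => F (x p) + N p) A z‖ ^ 2 = postVar θ x A z := by
  have h0 := h.inner_residual_of_mem_span x A z (predictor_mem_span (θ := θ) x _ subset_rfl z)
  rw [← real_inner_self_eq_norm_sq, inner_sub_right, h0, sub_zero, inner_sub_left,
    h.inner_signal, postVar, predictor, sum_inner]
  congr 1
  rw [dotProduct]
  refine Finset.sum_congr rfl fun a _ => ?_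
  rw [real_inner_smul_left, real_inner_comm, h.inner_signal_output, mul_comm]
  rfl

/-- The prediction is the best approximation by linear combinations of the outputs. -/
lemma norm_sq_sub_of_mem_span (h : IsFeatureModel θ F N) (x : Obs M → Input D)
    (A : Finset (Obs M)) (z : Input D) {u : E}
    (hu : u ∈ Submodule.span ℝ ((fun p => F (x p) + N p) '' (A : Set (Obs M)))) :
    ‖F z - u‖ ^ 2 =
      postVar θ x A z + ‖u - predictor θ x (fun p => F (x p) + N p) A z‖ ^ 2 := by
  have h0 := h.inner_residual_of_mem_span x A z
    (Submodule.sub_mem _ hu (predictor_mem_span (θ := θ) (A := A) x _ subset_rfl z))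
  have h1 := norm_sub_sq_real (F z - predictor θ x (fun p => F (x p) + N p) A z)
    (u - predictor θ x (fun p => F (x p) + N p) A z)
  rw [h0, sub_sub_sub_cancel_right, h.norm_sq_residual] at h1
  linarith

/-- Pythagoras for nested projections: the prediction from `A` is one of the competitors in the span
of the outputs of `B`. -/
lemma norm_sq_predictor_sub (h : IsFeatureModel θ F N) (x : Obs M → Input D)
    {A B : Finset (Obs M)} (hAB : A ⊆ B) (z : Input D) :
    ‖predictor θ x (fun p => F (x p) + N p) B z -
      predictor θ x (fun p => F (x p) + N p) A z‖ ^ 2 = postVar θ x A z - postVar θ x B z := by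
  have h1 := h.norm_sq_sub_of_mem_span x B z (predictor_mem_span (θ := θ) x _ hAB z)
  rw [h.norm_sq_residual] at h1
  rw [h1, norm_sub_rev]
  ring

lemma postVar_anti (h : IsFeatureModel θ F N) (x : Obs M → Input D)
    {A B : Finset (Obs M)} (hAB : A ⊆ B) (z : Input D) :
    postVar θ x B z ≤ postVar θ x A z := by
  have := h.norm_sq_predictor_sub x hAB z
  nlinarith [sq_nonneg ‖predictor θ x (fun p => F (x p) + N p) B z -
      predictor θ x (fun p => F (x p) + N p) A z‖]

/-- If `F z` equalled its prediction, pairing with each `N b` would isolate the weight of `b` and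
force it to vanish; then `F z = 0`, against `kernel_self`. -/
lemma postVar_pos (h : IsFeatureModel θ F N) (x : Obs M → Input D)
    (A : Finset (Obs M)) (z : Input D) : 0 < postVar θ x A z := by
  rw [← h.norm_sq_residual]
  refine pow_pos (norm_pos_iff.mpr fun h0 => ?_) 2
  rw [sub_eq_zero] at h0
  have hw : ∀ b : A, krigingWeight θ x A z b = 0 := by
    intro b
    have h1 := h.inner_signal_noise z b
    rw [h0, predictor, sum_inner, Finset.sum_eq_single b] at h1
    · rw [real_inner_smul_left, inner_add_left, h.inner_signal_noise, h.inner_noise, if_pos rfl,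
        zero_add] at h1
      exact (mul_eq_zero.mp h1).resolve_right (pow_pos θ.noiseStd_pos 2).ne'
    · intro a _ hab
      rw [real_inner_smul_left, inner_add_left, h.inner_signal_noise, h.inner_noise,
        if_neg (fun hh => hab (Subtype.ext hh)), add_zero, mul_zero]
    · simp
  have h2 : F z = 0 := by
    rw [h0, predictor]
    exact Finset.sum_eq_zero fun a _ => by rw [hw a, zero_smul]
  have h3 := h.inner_signal z z
  rw [h2, inner_zero_left, θ.kernel_self] at h3
  exact (pow_pos θ.signalStd_pos 2).ne h3

lemma postVar_le (h : IsFeatureModel θ F N) (x : Obs M → Input D)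
    (A : Finset (Obs M)) (z : Input D) : postVar θ x A z ≤ θ.signalStd ^ 2 := by
  have := h.norm_sq_sub_of_mem_span x A z (Submodule.zero_mem _)
  rw [sub_zero, ← real_inner_self_eq_norm_sq, h.inner_signal, θ.kernel_self] at this
  nlinarith [sq_nonneg ‖0 - predictor θ x (fun p => F (x p) + N p) A z‖]

/-! ### Replacing an observation by the average of nearby ones -/

lemma continuous_signal (h : IsFeatureModel θ F N) : Continuous F := by
  refine continuous_iff_continuousAt.mpr fun z => ?_
  refine tendsto_iff_norm_sub_tendsto_zero.mpr ?_
  have h1 : ∀ z', ‖F z' - F z‖ = √(2 * θ.signalStd ^ 2 - 2 * θ.kernel z z') := by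
    intro z'
    rw [← Real.sqrt_sq (norm_nonneg (F z' - F z)), norm_sub_sq_real,
      ← real_inner_self_eq_norm_sq, ← real_inner_self_eq_norm_sq, h.inner_signal, h.inner_signal,
      h.inner_signal, θ.kernel_self, θ.kernel_self, θ.kernel_comm z' z]
    congr 1
    ring
  have h2 : Continuous fun z' => √(2 * θ.signalStd ^ 2 - 2 * θ.kernel z z') :=
    (continuous_const.sub (continuous_const.mul (θ.continuous_kernel_right z))).sqrt
  simp only [h1]
  have h3 := h2.tendsto z
  rwa [θ.kernel_self, sub_self, Real.sqrt_zero] at h3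

lemma norm_sq_sum_noise (h : IsFeatureModel θ F N) (B : Finset (Obs M)) :
    ‖∑ q ∈ B, N q‖ ^ 2 = B.card * θ.noiseStd ^ 2 := by
  rw [← real_inner_self_eq_norm_sq, sum_inner]
  simp only [inner_sum, h.inner_noise]
  simp

/-- A bias of at most `δ` from moving the inputs, plus the standard deviation of an average of
uncorrelated noises. -/
lemma norm_sub_average_le (h : IsFeatureModel θ F N) (x : Obs M → Input D) (v : Input D)
    {B : Finset (Obs M)} (hB : 0 < B.card) {δ : ℝ}
    (hδ : ∀ q ∈ B, ‖F v - F (x q)‖ ≤ δ) :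
    ‖F v - (B.card : ℝ)⁻¹ • ∑ q ∈ B, (F (x q) + N q)‖ ≤ δ + θ.noiseStd / √B.card := by
  have hc : (0 : ℝ) < B.card := by exact_mod_cast hB
  have h1 : F v - (B.card : ℝ)⁻¹ • ∑ q ∈ B, (F (x q) + N q) =
      (B.card : ℝ)⁻¹ • ∑ q ∈ B, (F v - F (x q)) - (B.card : ℝ)⁻¹ • ∑ q ∈ B, N q := by
    rw [Finset.sum_sub_distrib, Finset.sum_add_distrib, Finset.sum_const, smul_sub, smul_add,
      ← Nat.cast_smul_eq_nsmul ℝ, smul_smul, inv_mul_cancel₀ hc.ne', one_smul]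
    abel
  have h2 : ‖∑ q ∈ B, N q‖ = √B.card * θ.noiseStd := by
    rw [← Real.sqrt_sq (norm_nonneg _), h.norm_sq_sum_noise, Real.sqrt_mul hc.le,
      Real.sqrt_sq θ.noiseStd_pos.le]
  have h3 : ‖∑ q ∈ B, (F v - F (x q))‖ ≤ B.card * δ := by
    refine (norm_sum_le _ _).trans ((Finset.sum_le_sum hδ).trans ?_)
    rw [Finset.sum_const, nsmul_eq_mul]
  rw [h1]
  refine (norm_sub_le _ _).trans (add_le_add ?_ ?_)
  · rw [norm_smul, Real.norm_of_nonneg (inv_nonneg.mpr hc.le), inv_mul_le_iff₀ hc]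
    exact h3
  · rw [norm_smul, Real.norm_of_nonneg (inv_nonneg.mpr hc.le), h2]
    have h4 : √(B.card : ℝ) * √B.card = B.card := Real.mul_self_sqrt hc.le
    have h5 : 0 < √(B.card : ℝ) := Real.sqrt_pos.mpr hc
    rw [inv_mul_eq_div, div_eq_div_iff hc.ne' h5.ne' |>.mpr]
    linear_combination θ.noiseStd * h4

/-- A dataset with enough observations near every observation of `A` predicts almost as well as
`A` does. -/
lemma exists_postVar_le_add (h : IsFeatureModel θ F N) (x : Obs M → Input D)
    (A : Finset (Obs M)) (z : Input D) {η : ℝ} (hη : 0 < η) :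
    ∃ (m : ℕ) (r : Obs M → ℝ), (∀ a, 0 < r a) ∧ ∀ B : Finset (Obs M),
      (∀ a ∈ A, m ≤ (B.filter fun q => dist (x q) (x a) < r a).card) →
      postVar θ x B z ≤ postVar θ x A z + η := by
  set w := krigingWeight θ x A z with hw
  -- `v` is the residual with the noise of the outputs removed. That noise is orthogonal to `v`, so
  -- removing it can only shorten the residual.
  set v : E := F z - ∑ a : A, w a • F (x a) with hv
  set W : ℝ := ∑ a : A, |w a| with hW
  have hvA : ‖v‖ ^ 2 ≤ postVar θ x A z := by
    have h1 : F z - predictor θ x (fun p => F (x p) + N p) A z = v - ∑ a : A, w a • N a := by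
      simp only [predictor, smul_add, Finset.sum_add_distrib, hv, ← hw]
      abel
    have h2 : inner ℝ v (∑ a : A, w a • N a) = 0 := by
      rw [inner_sum]
      refine Finset.sum_eq_zero fun a _ => ?_
      rw [real_inner_smul_right, hv, inner_sub_left, h.inner_signal_noise, sum_inner,
        Finset.sum_eq_zero, sub_zero, mul_zero]
      intro b _
      rw [real_inner_smul_left, h.inner_signal_noise, mul_zero]
    rw [← h.norm_sq_residual, h1, norm_sub_sq_real v, h2]
    nlinarith [sq_nonneg ‖∑ a : A, w a • N a‖]
  -- `W * δ` is the cost of replacing every `F (x a)` by a vector within `δ`. The budget `δ` is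
  -- split below into halves for the noise, through `m`, and for the bias, through `r`.
  obtain ⟨δ, hδη, hδ⟩ : ∃ δ : ℝ, (‖v‖ + W * δ) ^ 2 < ‖v‖ ^ 2 + η ∧ 0 < δ := by
    have h1 : Continuous fun δ : ℝ => (‖v‖ + W * δ) ^ 2 := by fun_prop
    have h2 := (h1.tendsto 0).mono_left (nhdsWithin_le_nhds (s := Set.Ioi 0))
    rw [mul_zero, add_zero] at h2
    exact ((h2.eventually_lt_const (lt_add_of_pos_right _ hη)).and self_mem_nhdsWithin).exists
  obtain ⟨m, hm⟩ := exists_nat_ge (max 1 ((2 * θ.noiseStd / δ) ^ 2))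
  have hm1 : (1 : ℝ) ≤ m := (le_max_left _ _).trans hm
  have hm0 : 0 < m := by exact_mod_cast zero_lt_one.trans_le hm1
  have hmδ : θ.noiseStd / √m ≤ δ / 2 := by
    have h1 : 2 * θ.noiseStd / δ ≤ √m := Real.le_sqrt_of_sq_le ((le_max_right _ _).trans hm)
    rw [div_le_iff₀ hδ] at h1
    rw [div_le_iff₀ (Real.sqrt_pos.mpr (zero_lt_one.trans_le hm1))]
    linarith
  have hr : ∀ a : Obs M, ∃ r : ℝ, 0 < r ∧ ∀ q, dist (x q) (x a) < r →
      ‖F (x a) - F (x q)‖ ≤ δ / 2 := by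
    intro a
    obtain ⟨r, hr, hr'⟩ := Metric.continuous_iff.mp h.continuous_signal (x a) (δ / 2)
      (half_pos hδ)
    refine ⟨r, hr, fun q hq => ?_⟩
    rw [← dist_eq_norm, dist_comm]
    exact (hr' _ hq).le
  choose r hr hr' using hr
  refine ⟨m, r, hr, fun B hB => ?_⟩
  -- The sets for different `a` may overlap: their errors are added by the triangle inequality, not
  -- by orthogonality.
  have hS : ∀ a : A, ∃ S ⊆ B.filter (fun q => dist (x q) (x a) < r a), S.card = m :=
    fun a => Finset.exists_subset_card_eq (hB a a.2)
  choose S hSB hSm using hS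
  set u : E := ∑ a : A, w a • ((m : ℝ)⁻¹ • ∑ q ∈ S a, (F (x q) + N q)) with hu
  have hu_mem : u ∈ Submodule.span ℝ ((fun p => F (x p) + N p) '' (B : Set (Obs M))) :=
    Submodule.sum_mem _ fun a _ => Submodule.smul_mem _ _ <| Submodule.smul_mem _ _ <|
      Submodule.sum_mem _ fun q hq => Submodule.subset_span
        ⟨q, (Finset.mem_filter.mp (hSB a hq)).1, rfl⟩
  have hFu : ‖F z - u‖ ≤ ‖v‖ + W * δ := by
    have h1 : F z - u = v + ∑ a : A, w a •
        (F (x a) - (m : ℝ)⁻¹ • ∑ q ∈ S a, (F (x q) + N q)) := by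
      simp only [smul_sub, Finset.sum_sub_distrib, hv, hu]
      abel
    rw [h1]
    refine (norm_add_le _ _).trans (add_le_add_right ((norm_sum_le _ _).trans ?_) _)
    rw [hW, Finset.sum_mul]
    refine Finset.sum_le_sum fun a _ => ?_
    rw [norm_smul, Real.norm_eq_abs]
    refine mul_le_mul_of_nonneg_left ?_ (abs_nonneg _)
    have h2 := h.norm_sub_average_le x (x a) (B := S a) ((hSm a).symm ▸ hm0) (δ := δ / 2)
      fun q hq => hr' a q (Finset.mem_filter.mp (hSB a hq)).2
    rw [hSm] at h2
    linarith
  have h3 := h.norm_sq_sub_of_mem_span x B z hu_mem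
  have h4 : ‖F z - u‖ ^ 2 ≤ (‖v‖ + W * δ) ^ 2 := pow_le_pow_left₀ (norm_nonneg _) hFu 2
  nlinarith [sq_nonneg ‖u - predictor θ x (fun p => F (x p) + N p) B z‖]

end IsFeatureModel

/-! ### Convergence of average consensus -/

section Consensus

variable {M : ℕ} (G : ℕ → SimpleGraph (Fin M)) (ε : ℝ) (t₀ : ℕ) (w₀ : Fin M → ℝ)

open Classical in
/-- The sum of the squared differences along the edges of a graph, each edge counted twice. -/
noncomputable def edgeEnergy (H : SimpleGraph (Fin M)) (w : Fin M → ℝ) : ℝ :=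
  ∑ i, ∑ j, if H.Adj i j then (w j - w i) ^ 2 else 0

open Classical in
lemma edgeEnergy_nonneg (H : SimpleGraph (Fin M)) (w : Fin M → ℝ) : 0 ≤ edgeEnergy H w :=
  Finset.sum_nonneg fun i _ => Finset.sum_nonneg fun j _ => by split_ifs <;> positivity

open Classical in
lemma sq_sub_le_edgeEnergy {H : SimpleGraph (Fin M)} (w : Fin M → ℝ) {i j : Fin M}
    (hij : H.Adj i j) : (w j - w i) ^ 2 ≤ edgeEnergy H w := by
  have h0 : ∀ i j : Fin M, 0 ≤ if H.Adj i j then (w j - w i) ^ 2 else 0 := by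
    intro i j
    split_ifs <;> positivity
  calc (w j - w i) ^ 2 = if H.Adj i j then (w j - w i) ^ 2 else 0 := by rw [if_pos hij]
    _ ≤ ∑ j, if H.Adj i j then (w j - w i) ^ 2 else 0 :=
      Finset.single_le_sum (f := fun j => if H.Adj i j then (w j - w i) ^ 2 else 0)
        (fun j _ => h0 i j) (Finset.mem_univ j)
    _ ≤ edgeEnergy H w :=
      Finset.single_le_sum (f := fun i => ∑ j, if H.Adj i j then (w j - w i) ^ 2 else 0)
        (fun i _ => Finset.sum_nonneg fun j _ => h0 i j) (Finset.mem_univ i)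

open Classical in
lemma sum_sum_adj_sub_eq_zero (H : SimpleGraph (Fin M)) (w : Fin M → ℝ) :
    ∑ i, ∑ j, (if H.Adj i j then w j - w i else 0) = 0 := by
  have h1 : ∑ i, ∑ j, (if H.Adj i j then w j - w i else 0) =
      -∑ i, ∑ j, (if H.Adj i j then w j - w i else 0) := by
    conv_lhs => rw [Finset.sum_comm]
    rw [← Finset.sum_neg_distrib]
    refine Finset.sum_congr rfl fun i _ => ?_
    rw [← Finset.sum_neg_distrib]
    refine Finset.sum_congr rfl fun j _ => ?_
    simp only [H.adj_comm j i]
    split_ifs <;> ring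
  linarith

-- Discrete Green identity: exchanging the two ends of each edge and averaging the two forms
-- produces the squared differences.
open Classical in
lemma sum_mul_sum_adj_sub (H : SimpleGraph (Fin M)) (w : Fin M → ℝ) :
    2 * ∑ i, w i * ∑ j, (if H.Adj i j then w j - w i else 0) = -edgeEnergy H w := by
  have h1 : ∑ i, w i * ∑ j, (if H.Adj i j then w j - w i else 0) =
      ∑ i, ∑ j, (if H.Adj i j then w i * (w j - w i) else 0) := by
    refine Finset.sum_congr rfl fun i _ => ?_
    rw [Finset.mul_sum]
    exact Finset.sum_congr rfl fun j _ => by rw [mul_ite, mul_zero]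
  have h2 : ∑ i, w i * ∑ j, (if H.Adj i j then w j - w i else 0) =
      ∑ i, ∑ j, (if H.Adj i j then w j * (w i - w j) else 0) := by
    rw [h1, Finset.sum_comm]
    exact Finset.sum_congr rfl fun i _ => Finset.sum_congr rfl fun j _ => by
      simp only [H.adj_comm j i]
  rw [two_mul]
  nth_rw 1 [h1]
  rw [h2, edgeEnergy, ← Finset.sum_add_distrib, ← Finset.sum_neg_distrib]
  refine Finset.sum_congr rfl fun i _ => ?_
  rw [← Finset.sum_add_distrib, ← Finset.sum_neg_distrib]
  refine Finset.sum_congr rfl fun j _ => ?_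
  split_ifs <;> ring

open Classical in
lemma sq_sum_adj_sub_le (H : SimpleGraph (Fin M)) (w : Fin M → ℝ) (i : Fin M) :
    (∑ j, (if H.Adj i j then w j - w i else 0)) ^ 2 ≤
      (H.neighborSet i).ncard * ∑ j, (if H.Adj i j then (w j - w i) ^ 2 else 0) := by
  rw [← Finset.sum_filter, ← Finset.sum_filter]
  have hc : (H.neighborSet i).ncard = (Finset.univ.filter fun j => H.Adj i j).card := by
    rw [← Set.ncard_coe_finset]
    congr 1
    ext j
    simp
  rw [hc]
  exact sq_sum_le_card_mul_sum_sq

lemma sum_dac (s : ℕ) : ∑ i, dac G ε t₀ w₀ s i = ∑ i, w₀ i := by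
  induction s with
  | zero => rfl
  | succ s ih =>
    simp only [dac]
    rw [Finset.sum_add_distrib, ← Finset.mul_sum, sum_sum_adj_sub_eq_zero, mul_zero, add_zero, ih]

variable {G ε}

/-! ### Energy decay along the consensus iteration. -/

/-- One consensus step decreases the sum of squares by at least a multiple of the energy. -/
lemma sum_sq_dac_succ_le (hε : 0 < ε) {c : ℝ}
    (hc : ∀ t i, ε * ((G t).neighborSet i).ncard ≤ 1 - c) (s : ℕ) :
    ∑ i, dac G ε t₀ w₀ (s + 1) i ^ 2 ≤ ∑ i, dac G ε t₀ w₀ s i ^ 2 -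
      ε * c * edgeEnergy (G (t₀ + s)) (dac G ε t₀ w₀ s) := by
  classical
  set w := dac G ε t₀ w₀ s
  set H := G (t₀ + s) with hH
  have h1 : ∀ i, dac G ε t₀ w₀ (s + 1) i =
      w i + ε * ∑ j, (if H.Adj i j then w j - w i else 0) := fun i => by
    simp only [dac]
    congr!
  have h2 : ∑ i, dac G ε t₀ w₀ (s + 1) i ^ 2 = ∑ i, w i ^ 2 +
      ε * (2 * ∑ i, w i * ∑ j, (if H.Adj i j then w j - w i else 0)) +
      ε * ∑ i, ε * (∑ j, (if H.Adj i j then w j - w i else 0)) ^ 2 := by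
    have h3 : ∀ i, dac G ε t₀ w₀ (s + 1) i ^ 2 = w i ^ 2 +
        ε * (2 * (w i * ∑ j, (if H.Adj i j then w j - w i else 0))) +
        ε * (ε * (∑ j, (if H.Adj i j then w j - w i else 0)) ^ 2) := fun i => by
      rw [h1]
      ring
    simp only [h3]
    rw [Finset.sum_add_distrib, Finset.sum_add_distrib, ← Finset.mul_sum, ← Finset.mul_sum,
      ← Finset.mul_sum]
  have h3 : ∑ i, ε * (∑ j, (if H.Adj i j then w j - w i else 0)) ^ 2 ≤
      (1 - c) * edgeEnergy H w := by
    rw [edgeEnergy, Finset.mul_sum]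
    refine Finset.sum_le_sum fun i _ => ?_
    refine (mul_le_mul_of_nonneg_left (sq_sum_adj_sub_le H w i) hε.le).trans ?_
    rw [← mul_assoc]
    refine mul_le_mul_of_nonneg_right (hc _ _) (Finset.sum_nonneg fun j _ => ?_)
    split_ifs <;> positivity
  rw [h2, sum_mul_sum_adj_sub]
  -- The linear term contributes `-ε` times the energy, the quadratic term at most `ε * (1 - c)`
  -- times it.
  nlinarith [mul_le_mul_of_nonneg_left h3 hε.le]

/-- Degrees are integers at most `M`, so only finitely many values occur over all times and their
maximum is still below one. -/
lemma exists_uniform_gap (hε_lt : ∀ t i, ε * ((G t).neighborSet i).ncard < 1) :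
    ∃ c : ℝ, 0 < c ∧ ∀ t i, ε * ((G t).neighborSet i).ncard ≤ 1 - c := by
  have hfin : (Set.range fun p : ℕ × Fin M =>
      ε * (((G p.1).neighborSet p.2).ncard : ℝ)).Finite := by
    refine ((Set.finite_Iic M).image fun d : ℕ => ε * (d : ℝ)).subset ?_
    rintro _ ⟨p, rfl⟩
    refine ⟨((G p.1).neighborSet p.2).ncard, ?_, rfl⟩
    simpa using Set.ncard_le_ncard (Set.subset_univ ((G p.1).neighborSet p.2))
  rcases (Set.range fun p : ℕ × Fin M =>
      ε * (((G p.1).neighborSet p.2).ncard : ℝ)).eq_empty_or_nonempty with he | hne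
  · refine ⟨1, one_pos, fun t i => ?_⟩
    exact absurd (Set.mem_range_self (t, i)) (he ▸ Set.notMem_empty _)
  · obtain ⟨_, ⟨p, rfl⟩, hp⟩ := Set.exists_max_image _ id hfin hne
    refine ⟨1 - ε * ((G p.1).neighborSet p.2).ncard, sub_pos.mpr (hε_lt _ _), fun t i => ?_⟩
    rw [sub_sub_cancel]
    exact hp _ (Set.mem_range_self (t, i))

/-- The sum of squares is nonincreasing and bounded below, so its decrements, which dominate the
energy, tend to zero. -/
lemma tendsto_edgeEnergy_dac (hε : 0 < ε)
    (hε_lt : ∀ t i, ε * ((G t).neighborSet i).ncard < 1) :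
    Tendsto (fun s => edgeEnergy (G (t₀ + s)) (dac G ε t₀ w₀ s)) atTop (𝓝 0) := by
  obtain ⟨c, hc, hgap⟩ := exists_uniform_gap hε_lt
  set V : ℕ → ℝ := fun s => ∑ i, dac G ε t₀ w₀ s i ^ 2
  have hV : ∀ s, ε * c * edgeEnergy (G (t₀ + s)) (dac G ε t₀ w₀ s) ≤ V s - V (s + 1) := by
    intro s
    have := sum_sq_dac_succ_le t₀ w₀ hε hgap s
    simp only [V]
    linarith
  have hpos : 0 < ε * c := mul_pos hε hc
  have hanti : Antitone V := antitone_nat_of_succ_le fun s => by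
    nlinarith [hV s, mul_nonneg hpos.le (edgeEnergy_nonneg (G (t₀ + s)) (dac G ε t₀ w₀ s))]
  have hlim := tendsto_atTop_ciInf hanti
    ⟨0, by rintro _ ⟨s, rfl⟩; exact Finset.sum_nonneg fun i _ => sq_nonneg _⟩
  have hdiff := (hlim.sub (hlim.comp (tendsto_add_atTop_nat 1))).div_const (ε * c)
  rw [sub_self, zero_div] at hdiff
  refine squeeze_zero (fun s => edgeEnergy_nonneg _ _) (fun s => ?_) hdiff
  rw [le_div_iff₀ hpos, mul_comm]
  exact hV s

lemma abs_dac_succ_sub_le (hε : 0 < ε) (s : ℕ) (i : Fin M) :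
    |dac G ε t₀ w₀ (s + 1) i - dac G ε t₀ w₀ s i| ≤
      ε * M * √(edgeEnergy (G (t₀ + s)) (dac G ε t₀ w₀ s)) := by
  classical
  simp only [dac]
  rw [add_sub_cancel_left, abs_mul, abs_of_pos hε, mul_assoc]
  refine mul_le_mul_of_nonneg_left ((Finset.abs_sum_le_sum_abs _ _).trans ?_) hε.le
  refine (Finset.sum_le_card_nsmul _ _
    (√(edgeEnergy (G (t₀ + s)) (dac G ε t₀ w₀ s))) fun j _ => ?_).trans_eq ?_
  · split_ifs with hij
    · exact Real.abs_le_sqrt (sq_sub_le_edgeEnergy _ hij)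
    · simp
  · simp

/-! ### From small differences along edges to agreement of all agents. -/

lemma abs_sub_le_length_mul {H : SimpleGraph (Fin M)} {w : Fin M → ℝ} {K : ℝ}
    (hK : ∀ i j, H.Adj i j → |w i - w j| ≤ K) {i j : Fin M} (p : H.Walk i j) :
    |w i - w j| ≤ p.length * K := by
  induction p with
  | nil => simp
  | cons hij p ih =>
    rw [SimpleGraph.Walk.length_cons]
    push_cast
    have h1 := hK _ _ hij
    have h2 := abs_sub_le (w _) (w _) (w _) |>.trans (add_le_add h1 ih)
    linarith

lemma abs_sub_le_of_connected {H : SimpleGraph (Fin M)} (hH : H.Connected) {w : Fin M → ℝ} {K : ℝ}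
    (hK0 : 0 ≤ K) (hK : ∀ i j, H.Adj i j → |w i - w j| ≤ K) (i j : Fin M) :
    |w i - w j| ≤ M * K := by
  classical
  obtain ⟨p⟩ := hH.preconnected i j
  refine (abs_sub_le_length_mul hK (p.toPath : H.Walk i j)).trans ?_
  refine mul_le_mul_of_nonneg_right ?_ hK0
  have := p.toPath.2.length_lt
  rw [Fintype.card_fin] at this
  exact_mod_cast this.le

/-- The values of the agents come together. -/
lemma tendsto_dac_sub_dac (hG : RepeatedlyConnected G) (hε : 0 < ε)
    (hε_lt : ∀ t i, ε * ((G t).neighborSet i).ncard < 1) {η : ℝ} (hη : 0 < η) :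
    ∀ᶠ s in atTop, ∀ i j, |dac G ε t₀ w₀ s i - dac G ε t₀ w₀ s j| ≤ η := by
  obtain ⟨γ, hγ, hconn⟩ := hG
  set q : ℕ → ℝ := fun s => √(edgeEnergy (G (t₀ + s)) (dac G ε t₀ w₀ s)) with hq_def
  have hq : Tendsto q atTop (𝓝 0) := by
    simpa using (tendsto_edgeEnergy_dac t₀ w₀ hε hε_lt).sqrt
  -- A path has fewer than `M` edges. Each edge costs `η'` when it is active, plus the drift of its
  -- two ends over at most `2 * γ` steps of size `ε * M * η'`.
  set C : ℝ := M * (1 + 2 * (2 * γ * (ε * M))) with hC_def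
  have hC : 0 ≤ C := by positivity
  obtain ⟨η', hη', hη'C⟩ : ∃ η' : ℝ, 0 < η' ∧ C * η' ≤ η := by
    refine ⟨η / (C + 1), by positivity, ?_⟩
    rw [mul_div_assoc', div_le_iff₀ (by positivity)]
    nlinarith
  obtain ⟨s₀, hs₀⟩ := eventually_atTop.mp (hq.eventually_le_const hη')
  filter_upwards [eventually_ge_atTop s₀] with s hs
  have hdrift : ∀ k i, |dac G ε t₀ w₀ (s + k) i - dac G ε t₀ w₀ s i| ≤ k * (ε * M * η') := by
    intro k i
    induction k with
    | zero => simp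
    | succ k ih =>
      have h1 := abs_dac_succ_sub_le (G := G) t₀ w₀ hε (s + k) i
      have h2 : ε * M * q (s + k) ≤ ε * M * η' :=
        mul_le_mul_of_nonneg_left (hs₀ (s + k) (by omega)) (by positivity)
      have h3 := (abs_sub_le (dac G ε t₀ w₀ (s + k + 1) i) (dac G ε t₀ w₀ (s + k) i)
        (dac G ε t₀ w₀ s i)).trans (add_le_add (h1.trans h2) ih)
      rw [← add_assoc]
      push_cast
      linarith
  -- The windows are aligned to absolute time, not to `t₀ + s`. This one starts after `t₀ + s` and
  -- ends at most `2 * γ` later.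
  set t := (t₀ + s) / γ + 1 with ht
  have ht1 : t₀ + s ≤ t * γ := by
    have := Nat.lt_div_mul_add (a := t₀ + s) hγ
    rw [ht, add_mul, one_mul]
    omega
  have ht2 : (t + 1) * γ ≤ t₀ + s + 2 * γ := by
    have := Nat.div_mul_le_self (t₀ + s) γ
    rw [ht, add_mul, add_mul, one_mul]
    omega
  intro i j
  refine (abs_sub_le_of_connected (hconn t) (K := (1 + 2 * (2 * γ * (ε * M))) * η')
    (by positivity) (fun i j hij => ?_) i j).trans ?_
  · simp only [SimpleGraph.iSup_adj] at hij
    obtain ⟨u, hu, hij⟩ := hij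
    rw [Finset.mem_Ico] at hu
    obtain ⟨k, rfl⟩ := Nat.exists_eq_add_of_le (ht1.trans hu.1)
    have hk : (k : ℝ) ≤ 2 * γ := by
      have : k ≤ 2 * γ := by omega
      exact_mod_cast this
    rw [add_assoc] at hij
    have h1 : |dac G ε t₀ w₀ (s + k) j - dac G ε t₀ w₀ (s + k) i| ≤ η' :=
      (Real.abs_le_sqrt (sq_sub_le_edgeEnergy _ hij)).trans (hs₀ (s + k) (by omega))
    have h2 : (k : ℝ) * (ε * M * η') ≤ 2 * γ * (ε * M * η') :=
      mul_le_mul_of_nonneg_right hk (by positivity)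
    have h3 := (hdrift k i).trans h2
    have h4 := (hdrift k j).trans h2
    rw [abs_le] at h1 h3 h4 ⊢
    constructor <;> nlinarith
  · rw [← mul_assoc]
    exact hη'C

/-- Average consensus converges to the average of the initial values. -/
theorem tendsto_dac (hG : RepeatedlyConnected G) (hε : 0 < ε)
    (hε_lt : ∀ t i, ε * ((G t).neighborSet i).ncard < 1) (i : Fin M) :
    Tendsto (fun s => dac G ε t₀ w₀ s i) atTop (𝓝 ((∑ j, w₀ j) / M)) := by
  rw [Metric.tendsto_atTop']
  intro η hη
  obtain ⟨s₀, hs₀⟩ := eventually_atTop.mp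
    (tendsto_dac_sub_dac t₀ w₀ hG hε hε_lt (half_pos hη))
  refine ⟨s₀, fun s hs => ?_⟩
  have hM : (0 : ℝ) < M := by exact_mod_cast i.pos
  -- As the sum is conserved, the distance to the initial average is an average of differences
  -- between agents.
  have h1 : dac G ε t₀ w₀ s i - (∑ j, w₀ j) / M =
      (∑ j, (dac G ε t₀ w₀ s i - dac G ε t₀ w₀ s j)) / M := by
    rw [Finset.sum_sub_distrib, sum_dac, Finset.sum_const, Finset.card_univ, Fintype.card_fin,
      nsmul_eq_mul]
    field_simp
  rw [Real.dist_eq, h1, abs_div, abs_of_pos hM, div_lt_iff₀ hM]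
  refine (Finset.abs_sum_le_sum_abs _ _).trans_lt ?_
  refine (Finset.sum_le_card_nsmul _ _ (η / 2) fun j _ => hs₀ s hs.le i j).trans_lt ?_
  rw [Finset.card_univ, Fintype.card_fin, nsmul_eq_mul]
  nlinarith

end Consensus

/-! ### Bounds for the aggregation rule -/

section Aggregation

variable {ι : Type*} [Fintype ι] {c : ℝ} {v β : ι → ℝ}

lemma inv_le_aggregated_precision (hv : ∀ i, 0 < v i) (hvc : ∀ i, v i ≤ c) (hβ : ∀ i, 0 ≤ β i) :
    c⁻¹ ≤ ∑ i, β i * (v i)⁻¹ + (1 - ∑ i, β i) * c⁻¹ := by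
  have h1 : ∑ i, β i * c⁻¹ ≤ ∑ i, β i * (v i)⁻¹ := Finset.sum_le_sum fun i _ =>
    mul_le_mul_of_nonneg_left (inv_anti₀ (hv i) (hvc i)) (hβ i)
  rw [← Finset.sum_mul] at h1
  linarith

lemma aggregated_precision_eq (hc : 0 < c) (hv : ∀ i, 0 < v i) :
    ∑ i, β i * (v i)⁻¹ + (1 - ∑ i, β i) * c⁻¹ =
      (1 + ∑ i, β i * (c - v i) / v i) * c⁻¹ := by
  have h1 : ∀ i, β i * (c - v i) / v i = c * (β i * (v i)⁻¹) - β i := fun i => by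
    have := (hv i).ne'
    field_simp
  simp only [h1]
  rw [Finset.sum_sub_distrib, ← Finset.mul_sum]
  field_simp
  ring

/-- The bound is uniform even when `v i` is tiny. Keeping only the `i`-th term of the precision, it
reduces to `β c ≤ 2 (v + β (c - v))`: either `β v ≤ v`, or `c ≤ 2 (c - v)`. -/
lemma aggregation_coefficient_le (hc : 0 < c) (hv : ∀ i, 0 < v i) (hvc : ∀ i, v i ≤ c)
    (hβ : ∀ i, 0 ≤ β i) (hβ' : ∀ i, β i ≤ 1 ∨ 2 * v i ≤ c) (i : ι) :
    (∑ i, β i * (v i)⁻¹ + (1 - ∑ i, β i) * c⁻¹)⁻¹ * (β i * (v i)⁻¹) ≤ 2 := by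
  have hpos := (inv_pos.mpr hc).trans_le (inv_le_aggregated_precision hv hvc hβ)
  rw [inv_mul_le_iff₀ hpos, aggregated_precision_eq hc hv]
  have h0 : ∀ i, 0 ≤ β i * (c - v i) / v i := fun i =>
    div_nonneg (mul_nonneg (hβ i) (sub_nonneg.mpr (hvc i))) (hv i).le
  have h1 : β i * (c - v i) / v i ≤ ∑ i, β i * (c - v i) / v i :=
    Finset.single_le_sum (f := fun i => β i * (c - v i) / v i) (fun i _ => h0 i)
      (Finset.mem_univ i)
  have h2 : β i * c ≤ 2 * (v i + β i * (c - v i)) := by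
    rcases hβ' i with h | h
    · nlinarith [hv i, hβ i, hvc i, mul_nonneg (hβ i) (sub_nonneg.mpr (hvc i)),
        mul_nonneg (sub_nonneg.mpr h) (hv i).le]
    · nlinarith [hv i, mul_nonneg (hβ i) (sub_nonneg.mpr h)]
  have h3 : β i * (v i)⁻¹ ≤ (1 + β i * (c - v i) / v i) * c⁻¹ * 2 := by
    have := hv i
    rw [← div_eq_mul_inv, ← div_eq_mul_inv, div_mul_eq_mul_div, div_le_div_iff₀ this hc]
    have h4 : (1 + β i * (c - v i) / v i) * 2 * v i = 2 * (v i + β i * (c - v i)) := by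
      field_simp
    rw [h4]
    exact h2
  refine h3.trans ?_
  have := inv_pos.mpr hc
  gcongr

lemma sub_aggregated_variance_le (hc : 0 < c) (hv : ∀ i, 0 < v i) (hvc : ∀ i, v i ≤ c)
    (hβ : ∀ i, 0 ≤ β i) (hβ' : ∀ i, β i ≤ 1 ∨ 2 * v i ≤ c) :
    c - (∑ i, β i * (v i)⁻¹ + (1 - ∑ i, β i) * c⁻¹)⁻¹ ≤ 2 * ∑ i, (c - v i) := by
  have hpos := (inv_pos.mpr hc).trans_le (inv_le_aggregated_precision hv hvc hβ)
  have h0 : ∀ i, 0 ≤ c - v i := fun i => sub_nonneg.mpr (hvc i)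
  -- If one `v i` is at most `c / 2`, the right side already exceeds `c`. Otherwise every weight is
  -- at most one and `c / v i < 2`, so the excess precision is controlled term by term.
  by_cases hlarge : ∃ i, 2 * v i ≤ c
  · obtain ⟨i, hi⟩ := hlarge
    have h1 : c - v i ≤ ∑ i, (c - v i) :=
      Finset.single_le_sum (f := fun i => c - v i) (fun i _ => h0 i) (Finset.mem_univ i)
    linarith [inv_pos.mpr hpos]
  · push Not at hlarge
    rw [aggregated_precision_eq hc hv, mul_inv, inv_inv]
    set B := ∑ i, β i * (c - v i) / v i
    have hb : ∀ i, 0 ≤ β i * (c - v i) / v i := fun i =>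
      div_nonneg (mul_nonneg (hβ i) (h0 i)) (hv i).le
    have hB : 0 ≤ B := Finset.sum_nonneg fun i _ => hb i
    have h1 : c - (1 + B)⁻¹ * c ≤ c * B := by
      have h2 : 1 - B ≤ (1 + B)⁻¹ := by
        rw [← one_div, le_div_iff₀ (by linarith)]
        nlinarith
      nlinarith
    refine h1.trans ?_
    rw [Finset.mul_sum, Finset.mul_sum]
    refine Finset.sum_le_sum fun i _ => ?_
    have hβ1 : β i ≤ 1 := (hβ' i).resolve_right (hlarge i).not_ge
    rw [mul_div_assoc', div_le_iff₀ (hv i)]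
    have h2 : β i * (c - v i) ≤ c - v i := by nlinarith [h0 i]
    have h3 : c * (β i * (c - v i)) ≤ (2 * v i) * (c - v i) :=
      mul_le_mul (hlarge i).le h2 (mul_nonneg (hβ i) (h0 i)) (by linarith [hv i])
    linarith

/-- The coefficients of the `μ i` and of `μc` sum to one, so the error is the same affine
combination of the individual errors. Those of the `μ i` lie in `[0, 2]`, which also bounds that of
`μc`. -/
lemma abs_sub_aggregated_mean_le (hc : 0 < c) (hv : ∀ i, 0 < v i) (hvc : ∀ i, v i ≤ c)
    (hβ : ∀ i, 0 ≤ β i) (hβ' : ∀ i, β i ≤ 1 ∨ 2 * v i ≤ c) (μ : ι → ℝ) (μc a : ℝ) :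
    |a - (∑ i, β i * (v i)⁻¹ + (1 - ∑ i, β i) * c⁻¹)⁻¹ *
        (∑ i, β i * (v i)⁻¹ * μ i - (∑ i, β i - 1) * c⁻¹ * μc)| ≤
      2 * ∑ i, |a - μ i| + (1 + 2 * Fintype.card ι) * |a - μc| := by
  have hpos := (inv_pos.mpr hc).trans_le (inv_le_aggregated_precision hv hvc hβ)
  have hle := aggregation_coefficient_le hc hv hvc hβ hβ'
  set p := ∑ i, β i * (v i)⁻¹ + (1 - ∑ i, β i) * c⁻¹ with hp
  set l : ι → ℝ := fun i => p⁻¹ * (β i * (v i)⁻¹) with hl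
  have hl0 : ∀ i, 0 ≤ l i := fun i =>
    mul_nonneg (inv_nonneg.mpr hpos.le) (mul_nonneg (hβ i) (inv_nonneg.mpr (hv i).le))
  have hsum : ∑ i, l i = p⁻¹ * ∑ i, β i * (v i)⁻¹ := by rw [Finset.mul_sum]
  have hlc : p⁻¹ * ((1 - ∑ i, β i) * c⁻¹) = 1 - ∑ i, l i := by
    rw [hsum, eq_sub_iff_add_eq, ← mul_add, add_comm, ← hp, inv_mul_cancel₀ hpos.ne']
  have h1 : a - p⁻¹ * (∑ i, β i * (v i)⁻¹ * μ i - (∑ i, β i - 1) * c⁻¹ * μc) =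
      ∑ i, l i * (a - μ i) + (1 - ∑ i, l i) * (a - μc) := by
    have h2 : ∑ i, l i * (a - μ i) = (∑ i, l i) * a - p⁻¹ * ∑ i, β i * (v i)⁻¹ * μ i := by
      rw [Finset.mul_sum, Finset.sum_mul, ← Finset.sum_sub_distrib]
      refine Finset.sum_congr rfl fun i _ => ?_
      simp only [hl]
      ring
    rw [h2]
    linear_combination -μc * hlc
  rw [h1]
  refine (abs_add_le _ _).trans (add_le_add ?_ ?_)
  · rw [Finset.mul_sum]
    refine (Finset.abs_sum_le_sum_abs _ _).trans (Finset.sum_le_sum fun i _ => ?_)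
    rw [abs_mul, abs_of_nonneg (hl0 i)]
    exact mul_le_mul_of_nonneg_right (hle i) (abs_nonneg _)
  · rw [abs_mul]
    refine mul_le_mul_of_nonneg_right ?_ (abs_nonneg _)
    have h3 : ∑ i, l i ≤ 2 * Fintype.card ι := by
      refine (Finset.sum_le_card_nsmul _ _ 2 fun i _ => hle i).trans_eq ?_
      rw [nsmul_eq_mul, mul_comm, Finset.card_univ]
    have h4 : 0 ≤ ∑ i, l i := Finset.sum_nonneg fun i _ => hl0 i
    rw [abs_le]
    constructor <;> linarith

end Aggregation

/-! ### The grBCM -/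

lemma localData_subset_fullData {M : ℕ} (n : ℕ) (i : Fin M) : localData n i ⊆ fullData M n :=
  Finset.product_subset_product (Finset.subset_univ _) subset_rfl

lemma commData_subset_augData {M : ℕ} (n : ℕ) (S : Fin M → Finset ℕ) (i : Fin M) :
    commData S ⊆ augData n S i :=
  Finset.subset_union_right

lemma commData_subset_fullData {M n : ℕ} {S : Fin M → Finset ℕ}
    (hS : ∀ i, S i ⊆ Finset.range n) : commData S ⊆ fullData M n :=
  Finset.biUnion_subset.mpr fun i _ =>
    Finset.product_subset_product (Finset.subset_univ _) (hS i)

lemma augData_subset_fullData {M n : ℕ} {S : Fin M → Finset ℕ}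
    (hS : ∀ i, S i ⊆ Finset.range n) (i : Fin M) : augData n S i ⊆ fullData M n :=
  Finset.union_subset (localData_subset_fullData n i) (commData_subset_fullData hS)

namespace IsFeatureModel

variable {D M : ℕ} {E : Type*} [NormedAddCommGroup E] [InnerProductSpace ℝ E]
  {θ : Hyper D} {F : Input D → E} {N : Obs M → E}

lemma grbcmWeight_nonneg (h : IsFeatureModel θ F N) (x : Obs M → Input D) (unitFirst : Bool)
    (n : ℕ) (S : Fin M → Finset ℕ) (z : Input D) (i : Fin M) :
    0 ≤ grbcmWeight θ x unitFirst n S z i := by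
  rw [grbcmWeight]
  split_ifs
  · exact zero_le_one
  · have := Real.log_le_log (h.postVar_pos x _ z)
      (h.postVar_anti x (commData_subset_augData n S i) z)
    linarith

/-- By `log r ≤ r - 1`, a logarithmic weight above one forces a variance ratio above three. This
dichotomy serves both choices of the weights. -/
lemma grbcmWeight_le_one_or (h : IsFeatureModel θ F N) (x : Obs M → Input D) (unitFirst : Bool)
    (n : ℕ) (S : Fin M → Finset ℕ) (z : Input D) (i : Fin M) :
    grbcmWeight θ x unitFirst n S z i ≤ 1 ∨
      2 * postVar θ x (augData n S i) z ≤ postVar θ x (commData S) z := by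
  by_contra! hcon
  obtain ⟨h1, h2⟩ := hcon
  rw [grbcmWeight] at h1
  split_ifs at h1
  · exact lt_irrefl _ h1
  · have hc := h.postVar_pos x (commData S) z
    have hv := h.postVar_pos x (augData n S i) z
    rw [← Real.log_div hc.ne' hv.ne'] at h1
    have h3 := Real.log_le_sub_one_of_pos (div_pos hc hv)
    have h4 := (div_lt_iff₀ hv).mpr h2
    linarith

lemma grbcm_precision_pos (h : IsFeatureModel θ F N) (x : Obs M → Input D) (unitFirst : Bool)
    (n : ℕ) (S : Fin M → Finset ℕ) (z : Input D) :
    0 < ∑ i, grbcmWeight θ x unitFirst n S z i * (postVar θ x (augData n S i) z)⁻¹ +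
      (1 - ∑ i, grbcmWeight θ x unitFirst n S z i) * (postVar θ x (commData S) z)⁻¹ :=
  (inv_pos.mpr (h.postVar_pos x (commData S) z)).trans_le <|
    inv_le_aggregated_precision (fun _ => h.postVar_pos x _ z)
      (fun i => h.postVar_anti x (commData_subset_augData n S i) z)
      (h.grbcmWeight_nonneg x unitFirst n S z)

lemma tendsto_decVar (h : IsFeatureModel θ F N) (x : Obs M → Input D) (unitFirst : Bool)
    (n : ℕ) (S : Fin M → Finset ℕ) (z : Input D)
    {G : ℕ → SimpleGraph (Fin M)} (hG : RepeatedlyConnected G) {ε : ℝ} (hε : 0 < ε)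
    (hε_lt : ∀ t i, ε * ((G t).neighborSet i).ncard < 1) (t₀ : ℕ) (i : Fin M) :
    Tendsto (fun s => decVar θ x unitFirst n S z G ε t₀ s i) atTop
      (𝓝 (grbcmVar θ x unitFirst n S z)) := by
  have hM : (M : ℝ) ≠ 0 := by exact_mod_cast i.pos.ne'
  have hrun : ∀ w₀ : Fin M → ℝ,
      Tendsto (fun s => M * dac G ε t₀ w₀ s i) atTop (𝓝 (∑ j, w₀ j)) := fun w₀ => by
    simpa only [mul_div_cancel₀ _ hM] using (tendsto_dac t₀ w₀ hG hε hε_lt i).const_mul (M : ℝ)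
  refine Tendsto.inv₀ ?_ (h.grbcm_precision_pos x unitFirst n S z).ne'
  exact (hrun _).add (((hrun _).const_sub 1).mul_const _)

lemma tendsto_decMean (h : IsFeatureModel θ F N) (x : Obs M → Input D) (y : Obs M → ℝ)
    (unitFirst : Bool) (n : ℕ) (S : Fin M → Finset ℕ) (z : Input D)
    {G : ℕ → SimpleGraph (Fin M)} (hG : RepeatedlyConnected G) {ε : ℝ} (hε : 0 < ε)
    (hε_lt : ∀ t i, ε * ((G t).neighborSet i).ncard < 1) (t₀ : ℕ) (i : Fin M) :
    Tendsto (fun s => decMean θ x y unitFirst n S z G ε t₀ s i) atTop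
      (𝓝 (grbcmMean θ x y unitFirst n S z)) := by
  have hM : (M : ℝ) ≠ 0 := by exact_mod_cast i.pos.ne'
  have hrun : ∀ w₀ : Fin M → ℝ,
      Tendsto (fun s => M * dac G ε t₀ w₀ s i) atTop (𝓝 (∑ j, w₀ j)) := fun w₀ => by
    simpa only [mul_div_cancel₀ _ hM] using (tendsto_dac t₀ w₀ hG hε hε_lt i).const_mul (M : ℝ)
  refine (h.tendsto_decVar x unitFirst n S z hG hε hε_lt t₀ i).mul ?_
  exact (hrun _).sub ((((hrun _).sub_const 1).mul_const _).mul_const _)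

/-- The full variance and the grBCM variance are both at most the communication variance. They fall
short of it by the gap and by at most `2 * M` times the gap; `2 * M + 1` covers both signs. -/
lemma abs_postVar_sub_grbcmVar_le (h : IsFeatureModel θ F N) (x : Obs M → Input D)
    (unitFirst : Bool) {n : ℕ} {S : Fin M → Finset ℕ} (hS : ∀ i, S i ⊆ Finset.range n)
    (z : Input D) :
    |postVar θ x (fullData M n) z - grbcmVar θ x unitFirst n S z| ≤
      (2 * M + 1) * (postVar θ x (commData S) z - postVar θ x (fullData M n) z) := by
  have hc := h.postVar_pos x (commData S) z
  have hle := inv_anti₀ (inv_pos.mpr hc) <|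
    inv_le_aggregated_precision (fun _ => h.postVar_pos x _ z)
      (fun i => h.postVar_anti x (commData_subset_augData n S i) z)
      (h.grbcmWeight_nonneg x unitFirst n S z)
  have hge := sub_aggregated_variance_le hc (fun _ => h.postVar_pos x _ z)
    (fun i => h.postVar_anti x (commData_subset_augData n S i) z)
    (h.grbcmWeight_nonneg x unitFirst n S z) (h.grbcmWeight_le_one_or x unitFirst n S z)
  have hsum : ∑ i : Fin M, (postVar θ x (commData S) z - postVar θ x (augData n S i) z) ≤
      M * (postVar θ x (commData S) z - postVar θ x (fullData M n) z) := by
    refine (Finset.sum_le_card_nsmul _ _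
      (postVar θ x (commData S) z - postVar θ x (fullData M n) z) ?_).trans_eq ?_
    · exact fun i _ => sub_le_sub_left (h.postVar_anti x (augData_subset_fullData hS i) z) _
    · rw [nsmul_eq_mul, Finset.card_univ, Fintype.card_fin]
  have hcf := h.postVar_anti x (commData_subset_fullData hS) z
  rw [inv_inv] at hle
  rw [grbcmVar, abs_le]
  have := mul_nonneg (Nat.cast_nonneg (α := ℝ) M) (sub_nonneg.mpr hcf)
  constructor <;> linarith

lemma abs_postMean_sub_grbcmMean_le (h : IsFeatureModel θ F N) (x : Obs M → Input D)
    (y : Obs M → ℝ) (unitFirst : Bool) (n : ℕ) (S : Fin M → Finset ℕ) (z : Input D) (a : ℝ) :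
    |a - grbcmMean θ x y unitFirst n S z| ≤
      2 * ∑ i, |a - postMean θ x y (augData n S i) z| +
        (1 + 2 * M) * |a - postMean θ x y (commData S) z| := by
  have := abs_sub_aggregated_mean_le (h.postVar_pos x (commData S) z)
    (fun _ => h.postVar_pos x _ z)
    (fun i => h.postVar_anti x (commData_subset_augData n S i) z)
    (h.grbcmWeight_nonneg x unitFirst n S z) (h.grbcmWeight_le_one_or x unitFirst n S z)
    (fun i => postMean θ x y (augData n S i) z) (postMean θ x y (commData S) z) a
  rwa [Fintype.card_fin] at this

end IsFeatureModel

/-! ### Sampling without replacement -/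

/-- Without denominators: a sample of size `s` drawn without replacement avoids `k` given elements
with probability at most `((n - s) / n) ^ k`. Each further element brings a factor `(n - k - s) / (n
- k) ≤ (n - s) / n`. -/
lemma choose_sub_mul_pow_le (n s : ℕ) {k : ℕ} (hk : k ≤ n) :
    (n - k).choose s * n ^ k ≤ n.choose s * (n - s) ^ k := by
  induction k with
  | zero => simp
  | succ k ih =>
    have ih := ih (by omega)
    obtain ⟨l, rfl⟩ : ∃ l, n = l + 1 + k := ⟨n - (k + 1), by omega⟩
    have h1 : l + 1 + k - (k + 1) = l := by omega
    have h2 : l + 1 + k - k = l + 1 := by omega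
    rw [h2] at ih
    rw [h1]
    have h3 := Nat.choose_mul_succ_eq l s
    have h4 : (l + 1 - s) * (l + 1 + k) ≤ (l + 1) * (l + 1 + k - s) := by
      rcases le_total (l + 1) s with hs | hs
      · rw [Nat.sub_eq_zero_of_le hs, zero_mul]
        exact Nat.zero_le _
      · obtain ⟨d, hd⟩ := Nat.exists_eq_add_of_le hs
        have h5 : l + 1 + k - s = d + k := by omega
        rw [h5, hd, Nat.add_sub_cancel_left]
        nlinarith
    refine le_of_mul_le_mul_left ?_ (Nat.succ_pos l)
    calc (l + 1) * (l.choose s * (l + 1 + k) ^ (k + 1))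
        = (l.choose s * (l + 1)) * (l + 1 + k) ^ k * (l + 1 + k) := by ring
      _ = ((l + 1).choose s * (l + 1 + k) ^ k) * ((l + 1 - s) * (l + 1 + k)) := by
        rw [h3]
        ring
      _ ≤ ((l + 1 + k).choose s * (l + 1 + k - s) ^ k) * ((l + 1) * (l + 1 + k - s)) :=
        Nat.mul_le_mul ih h4
      _ = (l + 1) * ((l + 1 + k).choose s * (l + 1 + k - s) ^ (k + 1)) := by ring

lemma uniformOn_powersetCard_disjoint_le {n s : ℕ} (hs : s ≤ n) {F : Finset ℕ}
    (hF : F ⊆ Finset.range n) :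
    uniformOn (Finset.powersetCard s (Finset.range n) : Set (Finset ℕ)) {T | Disjoint T F} ≤
      ENNReal.ofReal (((n - s : ℕ) : ℝ) / n) ^ F.card := by
  have hcard : F.card ≤ n := by simpa using Finset.card_le_card hF
  have hsub : (Finset.powersetCard s (Finset.range n) : Set (Finset ℕ)) ∩ {T | Disjoint T F} ⊆
      (Finset.powersetCard s (Finset.range n \ F) : Set (Finset ℕ)) := by
    rintro T ⟨hT, hTF⟩
    rw [Finset.mem_coe, Finset.mem_powersetCard] at hT ⊢
    exact ⟨Finset.subset_sdiff.mpr ⟨hT.1, hTF⟩, hT.2⟩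
  have hpos : 0 < n.choose s := Nat.choose_pos hs
  rw [uniformOn, cond_apply (Finset.measurableSet _), Measure.count_apply_finset,
    Finset.card_powersetCard, Finset.card_range]
  refine (mul_le_mul_right (measure_mono hsub) _).trans ?_
  rw [Measure.count_apply_finset, Finset.card_powersetCard, Finset.card_sdiff_of_subset hF,
    Finset.card_range, ← ENNReal.ofReal_pow (by positivity), ← ENNReal.div_eq_inv_mul]
  refine ENNReal.div_le_of_le_mul ?_
  rw [← ENNReal.ofReal_natCast, ← ENNReal.ofReal_natCast,
    ← ENNReal.ofReal_mul (by positivity)]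
  refine ENNReal.ofReal_le_ofReal ?_
  rcases Nat.eq_zero_or_pos n with rfl | hn
  · have h0 : F.card = 0 := by omega
    simp [h0]
  · have hn' : (0 : ℝ) < n := by exact_mod_cast hn
    rw [div_pow, div_mul_eq_mul_div, le_div_iff₀ (by positivity), mul_comm (_ ^ _)]
    exact_mod_cast choose_sub_mul_pow_le n s hcard

namespace IsFleetModel

variable {D M : ℕ} {Ω : Type*} [MeasurableSpace Ω] {P : Measure Ω} {θ : Hyper D}
  {f : Input D → Ω → ℝ} {e : Obs M → Ω → ℝ} {S : ℕ → Fin M → Ω → Finset ℕ}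

lemma ae_sample_subset (h : IsFleetModel P θ f e S) (n : ℕ) :
    ∀ᵐ ω ∂P, ∀ i, S n i ω ⊆ Finset.range n := by
  rw [ae_all_iff]
  intro i
  have h1 : ∀ᵐ T ∂uniformOn (Finset.powersetCard (n / M) (Finset.range n) : Set (Finset ℕ)),
      T ⊆ Finset.range n := by
    refine (ae_cond_mem (Finset.measurableSet _)).mono fun T hT => ?_
    exact (Finset.mem_powersetCard.mp hT).1
  exact ((h.law_S n i).ae_iff (.of_discrete)).mpr h1

/-- Once `M ≤ n`, rounding at most halves the sampling fraction: `⌊n / M⌋ / n ≥ 1 / (2 * M)`. -/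
lemma measure_sample_disjoint_le (h : IsFleetModel P θ f e S) {n : ℕ} (i : Fin M) (hn : M ≤ n)
    {F : Finset ℕ} (hF : F ⊆ Finset.range n) :
    P {ω | Disjoint (S n i ω) F} ≤ ENNReal.ofReal (1 - 1 / (2 * M)) ^ F.card := by
  have hM : 0 < M := i.pos
  have hM' : (0 : ℝ) < M := by exact_mod_cast hM
  have hn' : (0 : ℝ) < n := by exact_mod_cast hM.trans_le hn
  have h1 := (h.law_S n i).measure_eq (p := fun T => Disjoint T F) (.of_discrete)
  rw [h1]
  refine (uniformOn_powersetCard_disjoint_le (Nat.div_le_self n M) hF).trans ?_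
  refine pow_le_pow_left' (ENNReal.ofReal_le_ofReal ?_) _
  rw [Nat.cast_sub (Nat.div_le_self n M), sub_div, div_self hn'.ne']
  refine sub_le_sub_left ?_ 1
  rw [div_le_div_iff₀ (by positivity) hn', one_mul]
  have h2 : n < n / M * M + M := Nat.lt_div_mul_add hM
  have h3 : 1 ≤ n / M := (Nat.one_le_div_iff hM).mpr hn
  have h4 : n ≤ n / M * (2 * M) := by nlinarith
  exact_mod_cast h4

/-- `F` is built from `m` disjoint blocks, chosen before `n`, each large enough that the sample is
unlikely to miss it. A sample meeting every block has at least `m` points in `F`. -/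
lemma exists_finset_measure_card_lt_le (h : IsFleetModel P θ f e S) (i : Fin M) {δ : ℝ≥0∞}
    (hδ : δ ≠ 0) (m : ℕ) {Q : Set ℕ} (hQ : Q.Infinite) :
    ∃ F : Finset ℕ, (F : Set ℕ) ⊆ Q ∧
      ∀ᶠ n in atTop, P {ω | (S n i ω ∩ F).card < m} ≤ δ := by
  induction m generalizing δ with
  | zero => exact ⟨∅, by simp, by simp⟩
  | succ m ih =>
    have hδ2 : δ / 2 ≠ 0 := (ENNReal.half_pos hδ).ne'
    obtain ⟨F, hFQ, hF⟩ := ih hδ2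
    have hM : (0 : ℝ) < M := by exact_mod_cast i.pos
    have hρ : ENNReal.ofReal (1 - 1 / (2 * M)) < 1 := by
      rw [ENNReal.ofReal_lt_one]
      have : 0 < 1 / (2 * (M : ℝ)) := by positivity
      linarith
    obtain ⟨k, hk⟩ := ((ENNReal.tendsto_pow_atTop_nhds_zero_of_lt_one hρ).eventually_le_const
      (pos_iff_ne_zero.mpr hδ2)).exists
    obtain ⟨F', hF'Q, hF'k⟩ := (hQ.sdiff F.finite_toSet).exists_subset_card_eq k
    refine ⟨F ∪ F', ?_, ?_⟩
    · rw [Finset.coe_union]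
      exact Set.union_subset hFQ (hF'Q.trans Set.sdiff_subset)
    · have hdisj : Disjoint F F' := Finset.disjoint_right.mpr fun a ha => (hF'Q ha).2
      filter_upwards [hF, eventually_ge_atTop M, eventually_ge_atTop (F'.sup id + 1)]
        with n hn hnM hnF
      have hF'n : F' ⊆ Finset.range n := fun a ha =>
        Finset.mem_range.mpr ((Nat.lt_succ_of_le (Finset.le_sup (f := id) ha)).trans_le hnF)
      have hle := (h.measure_sample_disjoint_le i hnM hF'n).trans (hF'k ▸ hk)
      calc P {ω | (S n i ω ∩ (F ∪ F')).card < m + 1}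
          ≤ P ({ω | (S n i ω ∩ F).card < m} ∪ {ω | Disjoint (S n i ω) F'}) := by
            refine measure_mono fun ω hω => ?_
            simp only [Set.mem_ofPred_eq, Set.mem_union] at hω ⊢
            by_contra! hcon
            obtain ⟨h1, h2⟩ := hcon
            rw [Finset.not_disjoint_iff_nonempty_inter, ← Finset.card_pos] at h2
            rw [Finset.inter_union_distrib_left, Finset.card_union_of_disjoint
              (hdisj.mono Finset.inter_subset_right Finset.inter_subset_right)] at hω
            omega
        _ ≤ δ / 2 + δ / 2 := (measure_union_le _ _).trans (add_le_add hn hle)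
        _ = δ := ENNReal.add_halves δ

open Classical in
/-- The communication dataset meets every infinite set of observations in arbitrarily many
points, with probability tending to one. -/
lemma tendsto_measure_card_commData_lt (h : IsFleetModel P θ f e S) {Q : Set (Obs M)}
    (hQ : Q.Infinite) (m : ℕ) :
    Tendsto (fun n => P {ω | ((commData fun i => S n i ω).filter (· ∈ Q)).card < m}) atTop
      (𝓝 0) := by
  -- Pigeonhole over the finitely many agents. The sample of this one agent suffices, so no joint
  -- law of the samples is needed.
  obtain ⟨i, hi⟩ : ∃ i : Fin M, {j : ℕ | (i, j) ∈ Q}.Infinite := by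
    by_contra! hcon
    refine hQ ((Set.finite_iUnion fun i => (hcon i).image (Prod.mk i)).subset ?_)
    rintro ⟨i, j⟩ hij
    exact Set.mem_iUnion.mpr ⟨i, j, hij, rfl⟩
  rw [ENNReal.tendsto_nhds_zero]
  intro δ hδ
  obtain ⟨F, hFQ, hF⟩ := h.exists_finset_measure_card_lt_le i hδ.ne' m hi
  filter_upwards [hF] with n hn
  refine (measure_mono fun ω hω => ?_).trans hn
  refine lt_of_le_of_lt ?_ (show _ < m from hω)
  rw [← Finset.card_image_of_injective _ (Prod.mk_right_injective i)]
  refine Finset.card_le_card fun q hq => ?_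
  obtain ⟨j, hj, rfl⟩ := Finset.mem_image.mp hq
  rw [Finset.mem_inter] at hj
  refine Finset.mem_filter.mpr ⟨?_, hFQ hj.2⟩
  simp only [commData, Finset.mem_biUnion, Finset.mem_univ, true_and]
  exact ⟨i, by simpa using hj.1⟩

end IsFleetModel

/-! ### The observation model in `L²` -/

lemma inner_toLp_toLp {Ω : Type*} [MeasurableSpace Ω] {P : Measure Ω} {g h : Ω → ℝ}
    (hg : MemLp g 2 P) (hh : MemLp h 2 P) :
    inner ℝ (hg.toLp g) (hh.toLp h) = ∫ ω, g ω * h ω ∂P := by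
  rw [L2.inner_def]
  refine integral_congr_ae ?_
  filter_upwards [hg.coeFn_toLp, hh.coeFn_toLp] with ω h1 h2
  rw [h1, h2, RCLike.inner_apply, conj_trivial, mul_comm]

lemma eLpNorm_two_sq {Ω : Type*} [MeasurableSpace Ω] (P : Measure Ω) (g : Ω → ℝ) :
    eLpNorm g 2 P ^ 2 = ∫⁻ ω, ‖g ω‖ₑ ^ 2 ∂P := by
  simpa using eLpNorm_nnreal_pow_eq_lintegral (f := g) (μ := P) (p := 2) two_ne_zero

lemma measurable_postMean {D M : ℕ} {α : Type*} [MeasurableSpace α] (θ : Hyper D)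
    (x : Obs M → Input D) {y : α → Obs M → ℝ} (hy : ∀ p, Measurable fun a => y a p)
    (A : Finset (Obs M)) (z : Input D) : Measurable fun a => postMean θ x (y a) A z := by
  simp only [postMean_eq_sum]
  exact Finset.measurable_sum _ fun a _ => (hy a).const_mul _

namespace IsFleetModel

variable {D M : ℕ} {Ω : Type*} [MeasurableSpace Ω] {P : Measure Ω}
  {θ : Hyper D} {f : Input D → Ω → ℝ} {e : Obs M → Ω → ℝ} {S : ℕ → Fin M → Ω → Finset ℕ}

lemma memLp_signal (h : IsFleetModel P θ f e S) (z : Input D) : MemLp (f z) 2 P :=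
  (h.gaussian_f.hasGaussianLaw_eval z).memLp_two

lemma memLp_noise (h : IsFleetModel P θ f e S) (p : Obs M) : MemLp (e p) 2 P :=
  (h.law_e p).hasGaussianLaw.memLp_two

lemma measurable_output (h : IsFleetModel P θ f e S) (x : Obs M → Input D) (p : Obs M) :
    Measurable fun ω => outputs x f e ω p :=
  (h.measurable_f (x p)).add (h.measurable_e p)

lemma measurable_sample (h : IsFleetModel P θ f e S) (n : ℕ) :
    Measurable fun ω i => S n i ω :=
  measurable_pi_lambda _ fun i => h.measurable_S n i

lemma memLp_output (h : IsFleetModel P θ f e S) (x : Obs M → Input D) (p : Obs M) :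
    MemLp (fun ω => outputs x f e ω p) 2 P :=
  (h.memLp_signal (x p)).add (h.memLp_noise p)

lemma memLp_postMean (h : IsFleetModel P θ f e S) (x : Obs M → Input D) (A : Finset (Obs M))
    (z : Input D) : MemLp (fun ω => postMean θ x (outputs x f e ω) A z) 2 P := by
  simp only [postMean_eq_sum]
  exact memLp_finsetSum _ fun a _ => (h.memLp_output x a).const_mul _

lemma measurable_postMean_sample (h : IsFleetModel P θ f e S) (x : Obs M → Input D) (n : ℕ)
    (A : (Fin M → Finset ℕ) → Finset (Obs M)) (z : Input D) :
    Measurable fun ω => postMean θ x (outputs x f e ω) (A fun i => S n i ω) z := by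
  have h1 : Measurable fun q : (Fin M → Finset ℕ) × Ω =>
      postMean θ x (outputs x f e q.2) (A q.1) z :=
    measurable_from_prod_countable_right fun T =>
      measurable_postMean θ x (h.measurable_output x) (A T) z
  exact h1.comp ((h.measurable_sample n).prodMk measurable_id)

/-- The bridge from the Hilbert space lemmas to the random variable `postMean`: norms of predictors
become root mean squares. -/
lemma predictor_eq_toLp (h : IsFleetModel P θ f e S) (x : Obs M → Input D)
    (A : Finset (Obs M)) (z : Input D) :
    predictor θ x (fun p => (h.memLp_signal (x p)).toLp (f (x p)) +
      (h.memLp_noise p).toLp (e p)) A z = (h.memLp_postMean x A z).toLp _ := by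
  classical
  have h1 : ∀ B : Finset A, ∑ a ∈ B, krigingWeight θ x A z a •
      ((h.memLp_signal (x a)).toLp (f (x a)) + (h.memLp_noise a).toLp (e a)) =
      (memLp_finsetSum B fun a _ => (h.memLp_output x a).const_mul
        (krigingWeight θ x A z a)).toLp _ := by
    intro B
    induction B using Finset.induction_on with
    | empty =>
      rw [Finset.sum_empty]
      symm
      refine (Lp.eq_zero_iff_ae_eq_zero).mpr ((MemLp.coeFn_toLp _).trans ?_)
      simp only [Finset.sum_empty]
      rfl
    | insert a B ha ih =>
      rw [Finset.sum_insert ha, ih, ← MemLp.toLp_add, ← MemLp.toLp_const_smul, ← MemLp.toLp_add]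
      refine MemLp.toLp_congr _ _ (Eventually.of_forall fun ω => ?_)
      simp only [Finset.sum_insert ha]
      rfl
  rw [predictor, h1]
  refine MemLp.toLp_congr _ _ (Eventually.of_forall fun ω => ?_)
  simp only [postMean_eq_sum]

variable [IsProbabilityMeasure P]

/-- Latent function and noise, seen as vectors of `L²`. -/
lemma isFeatureModel (h : IsFleetModel P θ f e S) :
    IsFeatureModel θ (fun z => (h.memLp_signal z).toLp (f z))
      (fun p => (h.memLp_noise p).toLp (e p)) where
  inner_signal z z' := by
    have h1 := covariance_eq_sub (h.memLp_signal z) (h.memLp_signal z')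
    rw [h.cov_f, h.mean_f, zero_mul, sub_zero] at h1
    rw [inner_toLp_toLp, h1]
    rfl
  inner_noise p q := by
    have hmean : ∀ p, ∫ ω, e p ω ∂P = 0 := fun p => by
      rw [(h.law_e p).integral_eq, integral_id_gaussianReal]
    have h1 := covariance_eq_sub (h.memLp_noise p) (h.memLp_noise q)
    rw [hmean, zero_mul, sub_zero] at h1
    have h2 : inner ℝ ((h.memLp_noise p).toLp (e p)) ((h.memLp_noise q).toLp (e q)) =
        covariance (e p) (e q) P := by
      rw [inner_toLp_toLp, h1]
      rfl
    rw [h2]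
    split_ifs with hpq
    · subst hpq
      rw [covariance_self (h.measurable_e p).aemeasurable, (h.law_e p).variance_eq,
        variance_id_gaussianReal, Real.coe_toNNReal _ (sq_nonneg _)]
    · exact (h.indep_e.indepFun hpq).covariance_eq_zero (h.memLp_noise p) (h.memLp_noise q)
  inner_signal_noise z p := by
    have hind : IndepFun (f z) (e p) P :=
      h.indep_f_e.comp (measurable_pi_apply z) (measurable_pi_apply p)
    have h1 := covariance_eq_sub (h.memLp_signal z) (h.memLp_noise p)
    rw [hind.covariance_eq_zero (h.memLp_signal z) (h.memLp_noise p), h.mean_f, zero_mul,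
      sub_zero] at h1
    rw [inner_toLp_toLp]
    exact h1.symm

lemma lintegral_sq_postMean_sub (h : IsFleetModel P θ f e S) (x : Obs M → Input D)
    {A B : Finset (Obs M)} (hAB : A ⊆ B) (z : Input D) :
    ∫⁻ ω, ‖postMean θ x (outputs x f e ω) B z - postMean θ x (outputs x f e ω) A z‖ₑ ^ 2 ∂P =
      ENNReal.ofReal (postVar θ x A z - postVar θ x B z) := by
  have h1 := h.isFeatureModel.norm_sq_predictor_sub x hAB z
  rw [h.predictor_eq_toLp, h.predictor_eq_toLp, ← MemLp.toLp_sub] at h1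
  rw [← h1, ENNReal.ofReal_pow (norm_nonneg _), ofReal_norm, Lp.enorm_toLp,
    eLpNorm_two_sq]
  rfl

/-- The samples being independent of the data, the mean square of the difference of two
predictions is the mean of the difference of the variances. -/
lemma lintegral_sq_postMean_sub_sample (h : IsFleetModel P θ f e S) (x : Obs M → Input D) (n : ℕ)
    {A : (Fin M → Finset ℕ) → Finset (Obs M)} {B : Finset (Obs M)}
    (hAB : ∀ T, (∀ i, T i ⊆ Finset.range n) → A T ⊆ B) (z : Input D) :
    ∫⁻ ω, ‖postMean θ x (outputs x f e ω) B z -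
      postMean θ x (outputs x f e ω) (A fun i => S n i ω) z‖ₑ ^ 2 ∂P =
      ∫⁻ ω, ENNReal.ofReal (postVar θ x (A fun i => S n i ω) z - postVar θ x B z) ∂P := by
  -- Independence makes the law of `(X, Y)` a product, so the samples can be frozen and the identity
  -- for fixed nested datasets applied inside the integral.
  set X : Ω → Fin M → Finset ℕ := fun ω i => S n i ω
  set Y : Ω → (Input D → ℝ) × (Obs M → ℝ) := fun ω => (fun z => f z ω, fun p => e p ω)
  have hX : Measurable X := h.measurable_sample n
  have hY : Measurable Y := (measurable_pi_lambda _ fun z => h.measurable_f z).prodMk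
    (measurable_pi_lambda _ fun p => h.measurable_e p)
  have hXY : IndepFun X Y P := h.indep_S.comp (measurable_pi_apply n) measurable_id
  set y : (Input D → ℝ) × (Obs M → ℝ) → Obs M → ℝ := fun q p => q.1 (x p) + q.2 p
  have hy : ∀ p, Measurable fun q => y q p := fun p =>
    ((measurable_pi_apply (x p)).comp measurable_fst).add
      ((measurable_pi_apply p).comp measurable_snd)
  set K : (Fin M → Finset ℕ) × ((Input D → ℝ) × (Obs M → ℝ)) → ℝ≥0∞ := fun q =>
    ‖postMean θ x (y q.2) B z - postMean θ x (y q.2) (A q.1) z‖ₑ ^ 2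
  have hK : Measurable K := measurable_from_prod_countable_right fun T =>
    ((measurable_postMean θ x hy B z).sub (measurable_postMean θ x hy (A T) z)).enorm.pow_const 2
  calc ∫⁻ ω, ‖postMean θ x (outputs x f e ω) B z -
        postMean θ x (outputs x f e ω) (A (X ω)) z‖ₑ ^ 2 ∂P
      = ∫⁻ ω, K (X ω, Y ω) ∂P := rfl
    _ = ∫⁻ q, K q ∂(P.map fun ω => (X ω, Y ω)) := (lintegral_map hK (hX.prodMk hY)).symm
    _ = ∫⁻ q, K q ∂((P.map X).prod (P.map Y)) := by
      rw [(indepFun_iff_map_prod_eq_prod_map_map hX.aemeasurable hY.aemeasurable).mp hXY]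
    _ = ∫⁻ T, ∫⁻ q, K (T, q) ∂(P.map Y) ∂(P.map X) := by
      have : IsProbabilityMeasure (P.map Y) := Measure.isProbabilityMeasure_map hY.aemeasurable
      exact lintegral_prod _ hK.aemeasurable
    _ = ∫⁻ ω, ∫⁻ q, K (X ω, q) ∂(P.map Y) ∂P := lintegral_map (.of_discrete) hX
    _ = ∫⁻ ω, ENNReal.ofReal (postVar θ x (A (X ω)) z - postVar θ x B z) ∂P := by
      refine lintegral_congr_ae ?_
      filter_upwards [h.ae_sample_subset n] with ω hω
      refine (lintegral_map (hK.comp (measurable_prodMk_left (x := X ω))) hY).trans ?_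
      exact h.lintegral_sq_postMean_sub x (hAB (X ω) hω) z

/-! ### Consistency -/

/-- The expected gap between the variances of the predictions from the communication dataset and
from the full dataset tends to zero. -/
lemma tendsto_lintegral_postVar_sub (h : IsFleetModel P θ f e S) {x : Obs M → Input D}
    (hinfill : ∀ p : Obs M, ∀ r : ℝ, 0 < r → {q : Obs M | dist (x q) (x p) < r}.Infinite)
    (z : Input D) :
    Tendsto (fun n => ∫⁻ ω, ENNReal.ofReal (postVar θ x (commData fun i => S n i ω) z -
      postVar θ x (fullData M n) z) ∂P) atTop (𝓝 0) := by
  classical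
  have hfm := h.isFeatureModel
  set V : ℕ → ℝ := fun n => postVar θ x (fullData M n) z
  have hV : Antitone V := fun m n hmn => hfm.postVar_anti x
    (Finset.product_subset_product subset_rfl (Finset.range_mono hmn)) z
  have hbdd : BddBelow (Set.range V) := ⟨0, by
    rintro _ ⟨n, rfl⟩
    exact (hfm.postVar_pos x _ z).le⟩
  rw [ENNReal.tendsto_nhds_zero]
  intro δ hδ
  obtain ⟨η, hη, hηδ⟩ : ∃ η : ℝ, 0 < η ∧ ENNReal.ofReal η + ENNReal.ofReal η ≤ δ := by
    obtain ⟨η, hη0, hη⟩ := ENNReal.lt_iff_exists_nnreal_btwn.mp (ENNReal.half_pos hδ.ne')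
    refine ⟨η, by exact_mod_cast hη0, ?_⟩
    rw [ENNReal.ofReal_coe_nnreal]
    exact (add_le_add hη.le hη.le).trans_eq (ENNReal.add_halves δ)
  -- The dataset at `n₀` is fixed from here on and is within `η / 2` of the limit; imitating it by
  -- sampled observations costs another `η / 2`.
  obtain ⟨n₀, hn₀⟩ := exists_lt_of_ciInf_lt (lt_add_of_pos_right (⨅ n, V n) (half_pos hη))
  obtain ⟨m, r, hr, hmr⟩ := hfm.exists_postVar_le_add x (fullData M n₀) z (half_pos hη)
  -- The event that some observation of the fixed dataset has fewer than `m` sampled ones nearby.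
  -- There the gap is only bounded by the prior variance.
  set bad : ℕ → Set Ω := fun n => ⋃ a ∈ fullData M n₀,
    {ω | ((commData fun i => S n i ω).filter
      (· ∈ {q : Obs M | dist (x q) (x a) < r a})).card < m}
  have hbad : Tendsto (fun n => ENNReal.ofReal (θ.signalStd ^ 2) * P (bad n)) atTop (𝓝 0) := by
    have h1 : Tendsto (fun n => ∑ a ∈ fullData M n₀,
        P {ω | ((commData fun i => S n i ω).filter
          (· ∈ {q : Obs M | dist (x q) (x a) < r a})).card < m}) atTop (𝓝 0) := by
      rw [← Finset.sum_const_zero (s := fullData M n₀)]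
      exact tendsto_finsetSum _ fun a _ => by
        convert h.tendsto_measure_card_commData_lt (hinfill a (r a) (hr a)) m
    have h2 := tendsto_of_tendsto_of_tendsto_of_le_of_le tendsto_const_nhds h1
      (fun n => zero_le) (fun n => measure_biUnion_finset_le _ _)
    have h3 := ENNReal.Tendsto.const_mul (a := ENNReal.ofReal (θ.signalStd ^ 2)) h2
      (Or.inr ENNReal.ofReal_ne_top)
    rwa [mul_zero] at h3
  filter_upwards [(ENNReal.tendsto_nhds_zero.mp hbad) (ENNReal.ofReal η)
    (ENNReal.ofReal_pos.mpr hη)] with n hn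
  refine le_trans ?_ hηδ
  calc ∫⁻ ω, ENNReal.ofReal (postVar θ x (commData fun i => S n i ω) z - V n) ∂P
      ≤ ∫⁻ ω, (ENNReal.ofReal η +
          (bad n).indicator (fun _ => ENNReal.ofReal (θ.signalStd ^ 2)) ω) ∂P := by
        refine lintegral_mono fun ω => ?_
        by_cases hω : ω ∈ bad n
        · rw [Set.indicator_of_mem hω]
          refine le_add_left (ENNReal.ofReal_le_ofReal ?_)
          linarith [hfm.postVar_le x (commData fun i => S n i ω) z,
            hfm.postVar_pos x (fullData M n) z]
        · rw [Set.indicator_of_notMem hω, add_zero]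
          refine ENNReal.ofReal_le_ofReal ?_
          have h3 : ∀ a ∈ fullData M n₀, m ≤ ((commData fun i => S n i ω).filter
              fun q => dist (x q) (x a) < r a).card := by
            intro a ha
            by_contra! hcon
            exact hω (Set.mem_biUnion ha (by simpa using hcon))
          have h4 := hmr _ h3
          have h5 : ⨅ n, V n ≤ V n := ciInf_le hbdd n
          linarith
    _ = ENNReal.ofReal η +
        ∫⁻ ω, (bad n).indicator (fun _ => ENNReal.ofReal (θ.signalStd ^ 2)) ω ∂P := by
      rw [lintegral_add_left measurable_const, lintegral_const, measure_univ, mul_one]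
    _ ≤ ENNReal.ofReal η + ENNReal.ofReal η :=
      add_le_add_right ((lintegral_indicator_const_le _ _).trans hn) _

end IsFleetModel

/-! ### Mean square convergence of the grBCM predictions. -/

lemma tendsto_eLpNorm_two_of_lintegral_sq {Ω : Type*} [MeasurableSpace Ω] {P : Measure Ω}
    {g : ℕ → Ω → ℝ} (hg : Tendsto (fun n => ∫⁻ ω, ‖g n ω‖ₑ ^ 2 ∂P) atTop (𝓝 0)) :
    Tendsto (fun n => eLpNorm (g n) 2 P) atTop (𝓝 0) := by
  have h1 : ∀ n, eLpNorm (g n) 2 P = (∫⁻ ω, ‖g n ω‖ₑ ^ 2 ∂P) ^ (1 / 2 : ℝ) := fun n => by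
    rw [eLpNorm_eq_lintegral_rpow_enorm_toReal two_ne_zero ENNReal.ofNat_ne_top]
    simp
  simp only [h1]
  have h2 := (ENNReal.continuous_rpow_const (y := (1 / 2 : ℝ))).tendsto 0 |>.comp hg
  rwa [ENNReal.zero_rpow_of_pos (by norm_num)] at h2

namespace IsFleetModel

variable {D M : ℕ} {Ω : Type*} [MeasurableSpace Ω] {P : Measure Ω} [IsProbabilityMeasure P]
  {θ : Hyper D} {f : Input D → Ω → ℝ} {e : Obs M → Ω → ℝ} {S : ℕ → Fin M → Ω → Finset ℕ}

/-- The mean square error is an expected variance gap, which is largest for the communication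
dataset itself. Stated for a general `A` to serve both it and the augmented datasets. -/
lemma tendsto_eLpNorm_postMean_sub (h : IsFleetModel P θ f e S) {x : Obs M → Input D}
    (hinfill : ∀ p : Obs M, ∀ r : ℝ, 0 < r → {q : Obs M | dist (x q) (x p) < r}.Infinite)
    (A : ℕ → (Fin M → Finset ℕ) → Finset (Obs M)) (hA : ∀ n T, commData T ⊆ A n T)
    (hA' : ∀ n T, (∀ i, T i ⊆ Finset.range n) → A n T ⊆ fullData M n) (z : Input D) :
    Tendsto (fun n => eLpNorm (fun ω => postMean θ x (outputs x f e ω) (fullData M n) z -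
      postMean θ x (outputs x f e ω) (A n fun i => S n i ω) z) 2 P) atTop (𝓝 0) := by
  refine tendsto_eLpNorm_two_of_lintegral_sq ?_
  refine tendsto_of_tendsto_of_tendsto_of_le_of_le tendsto_const_nhds
    (h.tendsto_lintegral_postVar_sub hinfill z) (fun n => zero_le) (fun n => ?_)
  simp only
  rw [h.lintegral_sq_postMean_sub_sample x n (hA' n) z]
  exact lintegral_mono fun ω => ENNReal.ofReal_le_ofReal
    (sub_le_sub_right (h.isFeatureModel.postVar_anti x (hA n _) z) _)

lemma tendsto_eLpNorm_grbcmMean (h : IsFleetModel P θ f e S) {x : Obs M → Input D}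
    (hinfill : ∀ p : Obs M, ∀ r : ℝ, 0 < r → {q : Obs M | dist (x q) (x p) < r}.Infinite)
    (unitFirst : Bool) (z : Input D) :
    Tendsto (fun n => eLpNorm (fun ω => postMean θ x (outputs x f e ω) (fullData M n) z -
      grbcmMean θ x (outputs x f e ω) unitFirst n (fun i => S n i ω) z) 2 P) atTop (𝓝 0) := by
  set a : ℕ → Fin M → Ω → ℝ := fun n i ω => postMean θ x (outputs x f e ω) (fullData M n) z -
    postMean θ x (outputs x f e ω) (augData n (fun i => S n i ω) i) z with ha
  set b : ℕ → Ω → ℝ := fun n ω => postMean θ x (outputs x f e ω) (fullData M n) z -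
    postMean θ x (outputs x f e ω) (commData fun i => S n i ω) z with hb
  have hlim_a : ∀ i, Tendsto (fun n => eLpNorm (a n i) 2 P) atTop (𝓝 0) := fun i =>
    h.tendsto_eLpNorm_postMean_sub hinfill (fun n T => augData n T i)
      (fun n T => commData_subset_augData n T i) (fun n T hT => augData_subset_fullData hT i) z
  have hlim_b : Tendsto (fun n => eLpNorm (b n) 2 P) atTop (𝓝 0) :=
    h.tendsto_eLpNorm_postMean_sub hinfill (fun n T => commData T)
      (fun n T => subset_rfl) (fun n T hT => commData_subset_fullData hT) z
  have hfull : ∀ n, Measurable fun ω => postMean θ x (outputs x f e ω) (fullData M n) z :=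
    fun n => measurable_postMean θ x (h.measurable_output x) _ z
  have hmeas_a : ∀ n i, Measurable (a n i) := fun n i =>
    (hfull n).sub (h.measurable_postMean_sample x n (fun T => augData n T i) z)
  have hmeas_b : ∀ n, Measurable (b n) := fun n =>
    (hfull n).sub (h.measurable_postMean_sample x n commData z)
  have hbound : ∀ n, eLpNorm (fun ω => postMean θ x (outputs x f e ω) (fullData M n) z -
      grbcmMean θ x (outputs x f e ω) unitFirst n (fun i => S n i ω) z) 2 P ≤
      ‖(2 : ℝ)‖ₑ * ∑ i, eLpNorm (a n i) 2 P + ‖(1 + 2 * M : ℝ)‖ₑ * eLpNorm (b n) 2 P := by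
    intro n
    calc _ ≤ eLpNorm ((2 : ℝ) • (∑ i, fun ω => ‖a n i ω‖) +
          (1 + 2 * M : ℝ) • fun ω => ‖b n ω‖) 2 P := by
          refine eLpNorm_mono_real fun ω => ?_
          simpa [ha, hb] using h.isFeatureModel.abs_postMean_sub_grbcmMean_le x
            (outputs x f e ω) unitFirst n (fun i => S n i ω) z
            (postMean θ x (outputs x f e ω) (fullData M n) z)
      _ ≤ ‖(2 : ℝ)‖ₑ * eLpNorm (∑ i, fun ω => ‖a n i ω‖) 2 P +
          ‖(1 + 2 * M : ℝ)‖ₑ * eLpNorm (fun ω => ‖b n ω‖) 2 P := by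
          rw [← eLpNorm_const_smul, ← eLpNorm_const_smul]
          refine eLpNorm_add_le ?_ ?_ one_le_two
          · exact (Finset.aestronglyMeasurable_sum _ fun i _ =>
              (hmeas_a n i).norm.aestronglyMeasurable).const_smul _
          · exact (hmeas_b n).norm.aestronglyMeasurable.const_smul _
      _ ≤ _ := by
          rw [eLpNorm_norm]
          gcongr
          refine (eLpNorm_sum_le (fun i _ => (hmeas_a n i).norm.aestronglyMeasurable)
            one_le_two).trans_eq ?_
          simp only [eLpNorm_norm]
  refine tendsto_of_tendsto_of_tendsto_of_le_of_le tendsto_const_nhds ?_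
    (fun n => zero_le) hbound
  have h1 := (ENNReal.Tendsto.const_mul (a := ‖(2 : ℝ)‖ₑ)
    (tendsto_finsetSum Finset.univ fun i _ => hlim_a i) (Or.inr enorm_ne_top)).add
    (ENNReal.Tendsto.const_mul (a := ‖(1 + 2 * M : ℝ)‖ₑ) hlim_b (Or.inr enorm_ne_top))
  simpa using h1

lemma tendsto_eLpNorm_grbcmVar (h : IsFleetModel P θ f e S) {x : Obs M → Input D}
    (hinfill : ∀ p : Obs M, ∀ r : ℝ, 0 < r → {q : Obs M | dist (x q) (x p) < r}.Infinite)
    (unitFirst : Bool) (z : Input D) :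
    Tendsto (fun n => eLpNorm (fun ω => postVar θ x (fullData M n) z -
      grbcmVar θ x unitFirst n (fun i => S n i ω) z) 2 P) atTop (𝓝 0) := by
  have hfm := h.isFeatureModel
  refine tendsto_eLpNorm_two_of_lintegral_sq ?_
  -- The gap is at most `σ_f²`, so its square is at most `σ_f²` times the gap, and convergence of
  -- the mean gap gives mean square convergence.
  set C : ℝ := (2 * M + 1) ^ 2 * θ.signalStd ^ 2 with hC
  have h1 := ENNReal.Tendsto.const_mul (a := ENNReal.ofReal C)
    (h.tendsto_lintegral_postVar_sub hinfill z) (Or.inr ENNReal.ofReal_ne_top)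
  rw [mul_zero] at h1
  refine tendsto_of_tendsto_of_tendsto_of_le_of_le tendsto_const_nhds h1
    (fun n => zero_le) (fun n => ?_)
  simp only
  rw [← lintegral_const_mul' _ _ ENNReal.ofReal_ne_top]
  refine lintegral_mono_ae ?_
  filter_upwards [h.ae_sample_subset n] with ω hω
  have h2 := hfm.abs_postVar_sub_grbcmVar_le x unitFirst hω z
  have h3 := hfm.postVar_anti x (commData_subset_fullData hω) z
  have h4 := hfm.postVar_le x (commData fun i => S n i ω) z
  have h5 := hfm.postVar_pos x (fullData M n) z
  rw [Real.enorm_eq_ofReal_abs, ← ENNReal.ofReal_pow (abs_nonneg _),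
    ← ENNReal.ofReal_mul (by positivity)]
  refine ENNReal.ofReal_le_ofReal ((pow_le_pow_left₀ (abs_nonneg _) h2 2).trans ?_)
  rw [mul_pow, hC, mul_assoc]
  refine mul_le_mul_of_nonneg_left ?_ (by positivity)
  rw [pow_two]
  exact mul_le_mul_of_nonneg_right (by linarith) (sub_nonneg.mpr h3)

end IsFleetModel

end DecGP

theorem mainTheorem5 {D M : ℕ} {Ω : Type*} [MeasurableSpace Ω]
    (P : Measure Ω) [IsProbabilityMeasure P]
    (θ : DecGP.Hyper D)
    (f : DecGP.Input D → Ω → ℝ) (e : DecGP.Obs M → Ω → ℝ) (S : ℕ → Fin M → Ω → Finset ℕ)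
    (hmodel : DecGP.IsFleetModel P θ f e S)
    (x : DecGP.Obs M → DecGP.Input D)
    (hinfill : ∀ p : DecGP.Obs M, ∀ r : ℝ, 0 < r →
      {q : DecGP.Obs M | dist (x q) (x p) < r}.Infinite)
    (G : ℕ → SimpleGraph (Fin M)) (hG : DecGP.RepeatedlyConnected G)
    (ε : ℝ) (hε_pos : 0 < ε) (hε_lt : ∀ t i, ε * ((G t).neighborSet i).ncard < 1)
    (unitFirst : Bool) :
    -- every consensus run reaches the average, from any initialization
    (∀ (t₀ : ℕ) (w₀ : Fin M → ℝ) (i : Fin M),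
      Tendsto (fun s => DecGP.dac G ε t₀ w₀ s i) atTop (𝓝 ((∑ j, w₀ j) / M))) ∧
    -- DEC-grBCM converges to common outputs, those of the grBCM, which are consistent
    ∃ muDec varDec : ℕ → DecGP.Input D → Ω → ℝ,
      (∀ (n : ℕ) (z : DecGP.Input D) (ω : Ω) (t₀ : ℕ) (i : Fin M),
        Tendsto (fun s => DecGP.decMean θ x (DecGP.outputs x f e ω) unitFirst n
          (fun j => S n j ω) z G ε t₀ s i) atTop (𝓝 (muDec n z ω)) ∧
        Tendsto (fun s => DecGP.decVar θ x unitFirst n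
          (fun j => S n j ω) z G ε t₀ s i) atTop (𝓝 (varDec n z ω))) ∧
      (∀ (n : ℕ) (z : DecGP.Input D) (ω : Ω),
        muDec n z ω = DecGP.grbcmMean θ x (DecGP.outputs x f e ω) unitFirst n
          (fun j => S n j ω) z ∧
        varDec n z ω = DecGP.grbcmVar θ x unitFirst n (fun j => S n j ω) z) ∧
      DecGP.Consistent P
        (fun n z ω => DecGP.postMean θ x (DecGP.outputs x f e ω) (DecGP.fullData M n) z)
        (fun n z _ => DecGP.postVar θ x (DecGP.fullData M n) z)
        muDec varDec := by
  have hfm := hmodel.isFeatureModel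
  refine ⟨fun t₀ w₀ i => DecGP.tendsto_dac t₀ w₀ hG hε_pos hε_lt i,
    fun n z ω => DecGP.grbcmMean θ x (DecGP.outputs x f e ω) unitFirst n (fun j => S n j ω) z,
    fun n z ω => DecGP.grbcmVar θ x unitFirst n (fun j => S n j ω) z,
    fun n z ω t₀ i => ⟨?_, ?_⟩, fun n z ω => ⟨rfl, rfl⟩, fun z => ⟨?_, ?_⟩⟩
  · exact hfm.tendsto_decMean x _ unitFirst n _ z hG hε_pos hε_lt t₀ i
  · exact hfm.tendsto_decVar x unitFirst n _ z hG hε_pos hε_lt t₀ i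
  · exact hmodel.tendsto_eLpNorm_grbcmMean hinfill unitFirst z
  · exact hmodel.tendsto_eLpNorm_grbcmVar hinfill unitFirst z
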